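/- **Constraints and the problem.** A *constraint* of arity $k$ is a function $h:\{0,1\}^k\to\mathbb R^{\ge 0}$. For a (finite or infinite) set $\mathcal F$ of constraints, MAX-PROD-CSP$(\mathcal F)$ is the following maximization problem. An instance consists of a number $n$ of Boolean variables $x_1,\dots,x_n$ and a finite set $H$ of pairs $\langle h,(x_{i_1},\dots,x_{i_k})\rangle$ with $h\in\mathcal F$ of arity $k$ and $i_1,\dots,i_k\in\{1,\dots,n\}$. The solutions are the assignments $\sigma:\{x_1,\dots,x_n\}\to\{0,1\}$. The measure of $\sigma$ is $\prod_{\langle h,(x_{i_1},\dots,x_{i_k})\rangle\in H}h(\sigma(x_{i_1}),\dots,\sigma(x_{i_k}))$. **Computation.** Since weights are arbitrary real numbers, algorithms are programs of a random access machine over the reals: finitely many registers and stacks of reals, rational constants, and one step for each exact operation $+,-,\times,\div$, comparison, push or pop, fair coin flip, or oracle call. Instances are finite words of real numbers, and the size $|x|$ of an instance is the length of its word. In an instance of MAX-PROD-CSP$(\mathcal F)$ the number $n$ is written in unary, and each element of $H$ is written as its arity, its variable indices and the table of the $2^k$ values of $h$ in lexicographic order. Solutions are binary words. **Optimization problems.**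 An optimization problem $P=(I,\mathrm{sol},m)$ has a set $I$ of instances, for each $x\in I$ a set $\mathrm{sol}(x)$ of solutions, a measure $m(x,y)\ge 0$ for $y\in\mathrm{sol}(x)$, and a goal (max or min); $m^*(x)$ is the optimum. For $r\ge1$, a solution $y\in \mathrm{sol}(x)$ is $r$-*approximate* if $1/r\le m(x,y)/m^*(x)\le r$, or, in case $m^*(x)=0$, if $m(x,y)=0$. $P$ is in NPO if instances and solutions are recognized in deterministic polynomial time, solutions have length polynomially bounded in $|x|$, and $m$ is computed in deterministic polynomial time. EXP-APX is the class of all $P$ in NPO for which there are a function $\alpha$ and a polynomial $p$ with $1\le\alpha(n)\le 2^{p(n)}$ for all $n\in\mathbb N$, and a deterministic polynomial-time algorithm that on every $x\in I$ outputs an $\alpha(|x|)$-approximate solution. **Reductions.** A *randomized approximation scheme* for $P$ is a randomized procedure that on every $(x,\varepsilon)\in I\times(0,1)$ outputs a $2^{\varepsilon}$-approximate solution with probability at least $3/4$. $P$ is *APT-reducible* to $Q=(I',\mathrm{sol}',m')$ if there are a randomized oracle program $N$ and polynomials $p,q$ such that, for every randomized approximation scheme $M$ for $Q$ (not necessarily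 efficient, nor even computable) used as oracle, with an independent outcome of $M$ for each call: (i) $N$ is a randomized approximation scheme for $P$; (ii) on input $(x,\varepsilon)$, every oracle call is of the form $(w,\delta)\in I'\times(0,1)$ with $1/\delta\le p(|x|,1/\varepsilon)$; (iii) on input $(x,\varepsilon)$, $N$ always halts within $q(|x|,1/\varepsilon)$ steps. **Lemma.** For every constraint set $\mathcal F$ there is a problem $Q$ in EXP-APX such that MAX-PROD-CSP$(\mathcal F)$ is APT-reducible to $Q$. -/

import Mathlib

open scoped NNReal ENNReal

noncomputable section

namespace MaxProd

/-! ## The model of computation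

Constraint weights are arbitrary nonnegative reals, so algorithms are programs of a random access
machine over the reals.  A program uses finitely many registers, each holding one real, and finitely
many stacks of reals.  Exact rational operations and comparisons of two registers, one push, one
pop, one coin flip and one oracle call each take one step.  The size of a word of reals is its
length.  The only constants of a program are rational. -/

/-- The memory of the machine. -/
structure Store where
  reg : ℕ → ℝ
  stk : ℕ → List ℝ

/-- Elementary deterministic instructions; registers and stacks are addressed by fixed numbers. -/
inductive Instr where
  | const (r : ℕ) (q : ℚ)
  | copy (r a : ℕ)
  | add (r a b : ℕ)
  | sub (r a b : ℕ)
  | mul (r a b : ℕ)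
  | div (r a b : ℕ)
  | push (k a : ℕ)
  | pop (r k : ℕ)

/-- The effect of an elementary instruction.  Dividing by zero and popping an empty stack both
yield the value `0`. -/
def Instr.exec : Instr → Store → Store
  | .const r q, s => { s with reg := Function.update s.reg r (q : ℝ) }
  | .copy r a, s => { s with reg := Function.update s.reg r (s.reg a) }
  | .add r a b, s => { s with reg := Function.update s.reg r (s.reg a + s.reg b) }
  | .sub r a b, s => { s with reg := Function.update s.reg r (s.reg a - s.reg b) }
  | .mul r a b, s => { s with reg := Function.update s.reg r (s.reg a * s.reg b) }
  | .div r a b, s => { s with reg := Function.update s.reg r (s.reg a / s.reg b) }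
  | .push k a, s => { s with stk := Function.update s.stk k (s.reg a :: s.stk k) }
  | .pop r k, s =>
      { reg := Function.update s.reg r ((s.stk k).headD 0)
        stk := Function.update s.stk k (s.stk k).tail }

/-- Tests for branching. -/
inductive Test where
  | le (a b : ℕ)
  | empty (k : ℕ)
  | neg (t : Test)

def Test.Holds : Test → Store → Prop
  | .le a b, s => s.reg a ≤ s.reg b
  | .empty k, s => s.stk k = []
  | .neg t, s => ¬ t.Holds s

/-- Programs.  `flip r` puts a fair random bit into register `r`.  `query k d a` asks the oracle
about the word on stack `k` with the error tolerance in register `d`, and writes the answer onto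
stack `a` in place of its former contents. -/
inductive Prog where
  | skip
  | instr (i : Instr)
  | flip (r : ℕ)
  | query (k d a : ℕ)
  | seq (P Q : Prog)
  | ite (t : Test) (P Q : Prog)
  | loop (t : Test) (P : Prog)

/-- A program that neither flips coins nor asks the oracle. -/
def Prog.Deterministic : Prog → Prop
  | .skip => True
  | .instr _ => True
  | .flip _ => False
  | .query _ _ _ => False
  | .seq P Q => P.Deterministic ∧ Q.Deterministic
  | .ite _ P Q => P.Deterministic ∧ Q.Deterministic
  | .loop _ P => P.Deterministic

/-- An oracle: for every word and every tolerance, a distribution of answers.  Every call draws a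
fresh, independent answer. -/
abbrev Oracle := List ℝ → ℝ → PMF (List ℝ)

/-- A configuration: the list of programs still to be executed, and the memory. -/
structure Cfg where
  todo : List Prog
  store : Store

open Classical in
/-- One step of the machine.  A configuration with nothing left to execute has halted. -/
def step (O : Oracle) : Cfg → PMF Cfg
  | ⟨[], s⟩ => PMF.pure ⟨[], s⟩
  | ⟨.skip :: K, s⟩ => PMF.pure ⟨K, s⟩
  | ⟨.instr i :: K, s⟩ => PMF.pure ⟨K, i.exec s⟩
  | ⟨.flip r :: K, s⟩ =>
      (PMF.uniformOfFintype Bool).map fun b =>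
        ⟨K, { s with reg := Function.update s.reg r (if b then 1 else 0) }⟩
  | ⟨.query k d a :: K, s⟩ =>
      (O (s.stk k) (s.reg d)).map fun w => ⟨K, { s with stk := Function.update s.stk a w }⟩
  | ⟨.seq P Q :: K, s⟩ => PMF.pure ⟨P :: Q :: K, s⟩
  | ⟨.ite t P Q :: K, s⟩ => PMF.pure (if t.Holds s then ⟨P :: K, s⟩ else ⟨Q :: K, s⟩)
  | ⟨.loop t P :: K, s⟩ => PMF.pure (if t.Holds s then ⟨P :: .loop t P :: K, s⟩ else ⟨K, s⟩)

/-- The distribution of the configuration after a given number of steps. -/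
def run (O : Oracle) : ℕ → Cfg → PMF Cfg
  | 0, c => PMF.pure c
  | t + 1, c => (step O c).bind (run O t)

/-- The memory at the start: `x` on stack `0`, `y` on stack `1`, `e` in register `0`, all other
stacks empty and all other registers `0`. -/
def load (x y : List ℝ) (e : ℝ) : Store where
  reg := fun r => if r = 0 then e else 0
  stk := fun k => if k = 0 then x else if k = 1 then y else []

/-- Every computation path from memory `s` halts within `t` steps, in a memory satisfying `Post`. -/
def HaltsWithin (O : Oracle) (P : Prog) (s : Store) (t : ℕ) (Post : Store → Prop) : Prop :=
  ∀ c ∈ (run O t ⟨[P], s⟩).support, c.todo = [] ∧ Post c.store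

/-- The trivial oracle, used where programs make no oracle calls. -/
def noOracle : Oracle := fun _ _ => PMF.pure []

/-- A binary word as a word of reals. -/
def bits (y : List Bool) : List ℝ := y.map fun b => if b then 1 else 0

/-! ## Optimization problems -/

inductive Goal where
  | maximize
  | minimize

/-- A combinatorial optimization problem.  Instances are presented to algorithms as words of reals,
solutions are binary words.  The values of the measure outside `sol X` play no role. -/
structure OptProblem where
  Inst : Type
  encode : Inst → List ℝ
  encode_injective : Function.Injective encode
  sol : Inst → Set (List Bool)
  measure : Inst → List Bool → ℝ≥0
  goal : Goal

namespace OptProblem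

/-- The size of an instance. -/
def size (P : OptProblem) (X : P.Inst) : ℕ := (P.encode X).length

def IsOptimal (P : OptProblem) (X : P.Inst) (y : List Bool) : Prop :=
  y ∈ P.sol X ∧
    match P.goal with
    | .maximize => ∀ z ∈ P.sol X, P.measure X z ≤ P.measure X y
    | .minimize => ∀ z ∈ P.sol X, P.measure X y ≤ P.measure X z

/-- `y` is an `r`-approximate solution for `X`. -/
def IsApprox (P : OptProblem) (r : ℝ) (X : P.Inst) (y : List Bool) : Prop :=
  y ∈ P.sol X ∧ ∃ z, P.IsOptimal X z ∧
    (P.measure X z = 0 → P.measure X y = 0) ∧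
    (P.measure X z ≠ 0 →
      1 / r ≤ |(P.measure X y : ℝ) / P.measure X z| ∧ |(P.measure X y : ℝ) / P.measure X z| ≤ r)

/-- The class NPO. -/
structure InNPO (P : OptProblem) : Prop where
  /-- instances are recognized in polynomial time -/
  inst_rec : ∃ A : Prog, A.Deterministic ∧ ∃ p : Polynomial ℕ, ∀ w : List ℝ,
    HaltsWithin noOracle A (load w [] 0) (p.eval w.length)
      fun s => s.reg 0 = 1 ↔ w ∈ Set.range P.encode
  /-- solutions are recognized in polynomial time -/
  sol_rec : ∃ A : Prog, A.Deterministic ∧ ∃ p : Polynomial ℕ, ∀ (X : P.Inst) (y : List Bool),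
    HaltsWithin noOracle A (load (P.encode X) (bits y) 0) (p.eval (P.size X + y.length))
      fun s => s.reg 0 = 1 ↔ y ∈ P.sol X
  /-- solutions are polynomially bounded -/
  sol_bound : ∃ p : Polynomial ℕ, ∀ (X : P.Inst), ∀ y ∈ P.sol X, y.length ≤ p.eval (P.size X)
  /-- the measure is computed in polynomial time -/
  measure_comp : ∃ A : Prog, A.Deterministic ∧ ∃ p : Polynomial ℕ,
    ∀ (X : P.Inst), ∀ y ∈ P.sol X,
      HaltsWithin noOracle A (load (P.encode X) (bits y) 0) (p.eval (P.size X + y.length))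
        fun s => s.reg 0 = P.measure X y

/-- There is a deterministic polynomial-time `α`-approximation algorithm, with output on
stack `1`. -/
def HasApproxAlgorithm (P : OptProblem) (α : ℕ → ℝ) : Prop :=
  ∃ A : Prog, A.Deterministic ∧ ∃ p : Polynomial ℕ, ∀ X : P.Inst,
    HaltsWithin noOracle A (load (P.encode X) [] 0) (p.eval (P.size X))
      fun s => ∃ y, s.stk 1 = bits y ∧ P.IsApprox (α (P.size X)) X y

/-- The class EXP-APX. -/
def EXPAPX : Set OptProblem :=
  {P | P.InNPO ∧ ∃ α : ℕ → ℝ,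
    (∃ p : Polynomial ℕ, ∀ n, 1 ≤ α n ∧ α n ≤ 2 ^ (p.eval n)) ∧ P.HasApproxAlgorithm α}

/-- `D`, given by its distribution of outputs on every instance and tolerance, is a randomized
approximation scheme. -/
def IsRandomizedScheme (P : OptProblem) (D : P.Inst → ℝ → PMF (List ℝ)) : Prop :=
  ∀ (X : P.Inst) (ε : ℝ), 0 < ε → ε < 1 →
    3 / 4 ≤ (D X ε).toOuterMeasure {w | ∃ y, w = bits y ∧ P.IsApprox ((2 : ℝ) ^ ε) X y}

/-- The value of a bivariate polynomial at `(|X|, 1/ε)`. -/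
def polyVal (P : OptProblem) (p : MvPolynomial (Fin 2) ℕ) (X : P.Inst) (ε : ℝ) : ℝ :=
  MvPolynomial.aeval ![(P.size X : ℝ), 1 / ε] p

/-- `P` is APT-reducible to `Q`: a randomized oracle program `N`, started with the encoding of `X`
on stack `0` and `ε` in register `0` and leaving its output on stack `1`, is a randomized
approximation scheme for `P`, whichever randomized approximation scheme for `Q` is its oracle.
The polynomials `p` (for the tolerances of oracle calls) and `q` (for the running time) do not
depend on the oracle. -/
def APTReduces (P Q : OptProblem) : Prop :=
  ∃ (N : Prog) (p q : MvPolynomial (Fin 2) ℕ), ∀ O : Oracle,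
    Q.IsRandomizedScheme (fun Y δ => O (Q.encode Y) δ) →
      P.IsRandomizedScheme (fun X ε =>
        (run O ⌊P.polyVal q X ε⌋₊ ⟨[N], load (P.encode X) [] ε⟩).map fun c => c.store.stk 1) ∧
      ∀ (X : P.Inst) (ε : ℝ), 0 < ε → ε < 1 →
        (∀ t, ∀ c ∈ (run O t ⟨[N], load (P.encode X) [] ε⟩).support,
          ∀ k d a K, c.todo = Prog.query k d a :: K →
            c.store.stk k ∈ Set.range Q.encode ∧
            0 < c.store.reg d ∧ c.store.reg d < 1 ∧ 1 / c.store.reg d ≤ P.polyVal p X ε) ∧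
        HaltsWithin O N (load (P.encode X) [] ε) ⌊P.polyVal q X ε⌋₊ fun _ => True

/-- `P` is APT-reducible to some problem of the class `C`. -/
def APTReducesToClass (P : OptProblem) (C : Set OptProblem) : Prop :=
  ∃ Q ∈ C, P.APTReduces Q

end OptProblem

/-! ## MAX-PROD-CSP -/

/-- A nonnegative-real-weighted Boolean constraint. -/
structure Constraint where
  arity : ℕ
  val : (Fin arity → Bool) → ℝ≥0

/-- The values of a function on `{0,1}^k` in lexicographic order. -/
def table : (k : ℕ) → ((Fin k → Bool) → ℝ≥0) → List ℝ
  | 0, f => [(f Fin.elim0 : ℝ)]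
  | k + 1, f =>
      table k (fun v => f (Fin.cons false v)) ++ table k (fun v => f (Fin.cons true v))

/-- A constraint together with the variables (out of `n`) to which it is applied. -/
structure App (n : ℕ) where
  con : Constraint
  args : Fin con.arity → Fin n

/-- An application is written as its arity, its variable indices and its table of values. -/
def App.encode {n : ℕ} (a : App n) : List ℝ :=
  (a.con.arity : ℝ) :: (List.ofFn (fun i => ((a.args i : ℕ) : ℝ)) ++ table a.con.arity a.con.val)

/-- An instance of MAX-PROD-CSP(F): a finite set of applications of constraints of `F`, listed
without repetition. -/
structure CSPInst (F : Set Constraint) where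
  numVars : ℕ
  apps : List (App numVars)
  nodup : apps.Nodup
  mem : ∀ a ∈ apps, a.con ∈ F

/-- The number of variables is written in unary, so that the size is at least that number. -/
def CSPInst.encode {F : Set Constraint} (X : CSPInst F) : List ℝ :=
  List.replicate X.numVars 1 ++ 0 :: X.apps.flatMap App.encode

/-- The objective value of an assignment, given as a binary word. -/
def CSPInst.value {F : Set Constraint} (X : CSPInst F) (y : List Bool) : ℝ≥0 :=
  (X.apps.map fun a => a.con.val fun i => y.getD (a.args i) false).prod

theorem table_length (k : ℕ) (f : (Fin k → Bool) → ℝ≥0) : (table k f).length = 2 ^ k := by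
  induction k with
  | zero => simp [table]
  | succ k ih => simp [table, ih, pow_succ, mul_two]

theorem table_injective (k : ℕ) : Function.Injective (table k) := by
  induction k with
  | zero =>
    intro f g h
    funext v
    have hv : v = Fin.elim0 := Subsingleton.elim _ _
    subst hv
    simpa [table] using h
  | succ k ih =>
    intro f g h
    obtain ⟨h0, h1⟩ := List.append_inj h (by simp [table_length])
    funext v
    rw [← Fin.cons_self_tail v]
    cases v 0
    · exact congrFun (ih h0) (Fin.tail v)
    · exact congrFun (ih h1) (Fin.tail v)

theorem App.encode_append_inj {n : ℕ} {a b : App n} {u v : List ℝ}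
    (h : a.encode ++ u = b.encode ++ v) : a = b ∧ u = v := by
  obtain ⟨⟨k, f⟩, s⟩ := a
  obtain ⟨⟨l, g⟩, t⟩ := b
  simp only [App.encode, List.cons_append, List.cons.injEq, Nat.cast_inj, List.append_assoc] at h
  obtain ⟨rfl, h⟩ := h
  obtain ⟨h1, h⟩ := List.append_inj h (by simp)
  obtain ⟨h2, h3⟩ := List.append_inj h (by simp [table_length])
  have hf : f = g := table_injective _ h2
  have hs : s = t := by
    funext i
    have := congrFun (List.ofFn_injective h1) i
    exact Fin.ext (by exact_mod_cast this)
  subst hf hs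
  exact ⟨rfl, h3⟩

theorem App.flatMap_encode_injective {n : ℕ} :
    Function.Injective fun l : List (App n) => l.flatMap App.encode := by
  intro l
  induction l with
  | nil =>
    rintro (_ | ⟨b, m⟩) h
    · rfl
    · simp [App.encode] at h
  | cons a l ih =>
    rintro (_ | ⟨b, m⟩) h
    · simp [App.encode] at h
    · simp only [List.flatMap_cons] at h
      obtain ⟨rfl, h'⟩ := App.encode_append_inj h
      rw [ih h']

theorem replicate_append_inj (n : ℕ) : ∀ (m : ℕ) (u v : List ℝ),
    List.replicate n (1 : ℝ) ++ 0 :: u = List.replicate m 1 ++ 0 :: v → n = m ∧ u = v := by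
  induction n with
  | zero =>
    rintro (_ | m) u v h
    · simpa using h
    · simp [List.replicate_succ] at h
  | succ n ih =>
    rintro (_ | m) u v h
    · simp [List.replicate_succ] at h
    · simp only [List.replicate_succ, List.cons_append, List.cons.injEq, true_and] at h
      obtain ⟨rfl, h'⟩ := ih m u v h
      exact ⟨rfl, h'⟩

theorem CSPInst.encode_injective (F : Set Constraint) :
    Function.Injective (CSPInst.encode (F := F)) := by
  rintro ⟨n, l, hl, hF⟩ ⟨m, l', hl', hF'⟩ h
  obtain ⟨h1, h2⟩ := replicate_append_inj _ _ _ _ h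
  dsimp only at h1
  subst h1
  have := App.flatMap_encode_injective h2
  dsimp only at this
  subst this
  rfl

/-- The maximization problem MAX-PROD-CSP(F). -/
def maxProdCSP (F : Set Constraint) : OptProblem where
  Inst := CSPInst F
  encode := CSPInst.encode
  encode_injective := CSPInst.encode_injective F
  sol := fun X => {y | y.length = X.numVars}
  measure := CSPInst.value
  goal := .maximize

end MaxProd

end

open scoped NNReal ENNReal

noncomputable section

namespace MaxProd

/-! ## Expectations along a computation -/

/-! The target problem, `improvement`, does not depend on `F`. Its instances carry a threshold, a
list of parity checks and a list of applications. An assignment whose product does not exceed the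
threshold has measure 1; any other has measure `2 ^ (p + 1)`, where `p` is the number of checks it
passes before its first failure. All measures lie between 1 and an exponential in the length, so any
fixed solution is an exponential approximation (`improvement_mem_EXPAPX`). Every real word is an
instance, so recognizing instances never involves `F`.

The reduction keeps a current assignment `c`, at first the zero assignment. In each round it draws
`n + 2` random homogeneous parity checks, asks the oracle for an assignment better than `c` with
tolerance 1/2, and moves to the answer only if that is a strict improvement. Tolerance 1/2 means a
factor `√2 < 2`, while measures are powers of 2, so a correct answer is optimal.

Let `S` be the set of assignments better than `c`, and let `2 |S| ≤ 2 ^ j ≤ 4 |S|`. As values never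
decrease, `S` omits the zero assignment. Hence each check is passed by each element of `S` with
probability 1/2, pairwise independently. By the Valiant–Vazirani argument a given `z ∈ S` is the
only element of `S` that passes the first `j` checks with probability at least `2 ^ (-j) - |S| 4 ^
(-j) ≥ 1 / (8 |S|)` (`le_average_isolates`). If that happens, a correct answer must be `z`
(`advance_eq_of_isolates`). Since the score counts the passed prefix, every `j` is served by one
query, and the reduction need not know `|S|`.

The isolated element is thus spread over `S` nearly uniformly, and an average element of `S` has at
most half of `S` above it (`sum_card_better`). With the success probability 3/4 of the oracle, the
expected number of better assignments drops by the factor `1 - 3/64 = 61/64` (`le_round`). After `16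
(n + 2)` rounds it is at most `2 ^ n * 2 ^ (-(n + 2)) = 1/4`, so an exact optimum is reached with
probability at least 3/4, whatever `ε` is.

At the level of programs everything is a lower bound on `expect`, the mass of paths that halt in
time and query only with tolerance 1/2. Applied to the constant 1 it gives the time bound and the
tolerance bound; applied to the indicator of success it gives the success probability. -/

/-- A pending oracle call with a tolerance other than `1 / 2`. -/
def BadQuery (c : Cfg) : Prop :=
  ∃ k d a K, c.todo = Prog.query k d a :: K ∧ c.store.reg d ≠ 1 / 2

open Classical in
/-- The expectation of `ψ` over the final memories of the paths that halt within `t` steps and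
ask the oracle with tolerance `1 / 2` only. -/
def expect (O : Oracle) (ψ : Store → ℝ≥0∞) : ℕ → Cfg → ℝ≥0∞
  | 0, c => if c.todo = [] then ψ c.store else 0
  | t + 1, c => if BadQuery c then 0 else ∑' c', step O c c' * expect O ψ t c'

theorem tsum_pure_mul {α : Type*} (a : α) (f : α → ℝ≥0∞) :
    ∑' b, PMF.pure a b * f b = f a := by
  rw [tsum_eq_single a]
  · simp
  · intro b hb
    simp [hb]

theorem tsum_map_mul {α β : Type*} (p : PMF α) (g : α → β) (f : β → ℝ≥0∞) :
    ∑' b, p.map g b * f b = ∑' a, p a * f (g a) := by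
  classical
  simp only [PMF.map_apply, ← ENNReal.tsum_mul_right]
  rw [ENNReal.tsum_comm]
  refine tsum_congr fun a => ?_
  rw [tsum_eq_single (g a)]
  · simp
  · intro b hb
    simp [hb]

section

variable {O : Oracle} {ψ : Store → ℝ≥0∞}

theorem expect_succ_of_step {c c' : Cfg} (hc : ¬ BadQuery c) (h : step O c = PMF.pure c') (t : ℕ) :
    expect O ψ (t + 1) c = expect O ψ t c' := by
  simp only [expect, if_neg hc, h, tsum_pure_mul]

theorem expect_halted (t : ℕ) (s : Store) : expect O ψ t ⟨[], s⟩ = ψ s := by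
  induction t with
  | zero => simp [expect]
  | succ t ih => rw [expect_succ_of_step (by simp [BadQuery]) rfl, ih]

/-- Unfinished paths count 0, so more time can only add mass. This is what allows all time bounds to
be used with slack. -/
theorem expect_le_succ (t : ℕ) (c : Cfg) : expect O ψ t c ≤ expect O ψ (t + 1) c := by
  induction t generalizing c with
  | zero =>
    obtain ⟨todo, s⟩ := c
    cases todo with
    | nil => simp [expect_halted]
    | cons P K => simp [expect]
  | succ t ih =>
    rw [expect, expect]
    split_ifs
    · exact le_rfl
    · exact ENNReal.tsum_le_tsum fun c' => mul_le_mul_right (ih c') _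

theorem expect_mono (c : Cfg) : Monotone fun t => expect O ψ t c :=
  monotone_nat_of_le_succ fun t => expect_le_succ t c

theorem expect_le_one (hψ : ∀ s, ψ s ≤ 1) (t : ℕ) (c : Cfg) : expect O ψ t c ≤ 1 := by
  induction t generalizing c with
  | zero =>
    rw [expect]
    split_ifs
    · exact hψ _
    · exact zero_le_one
  | succ t ih =>
    rw [expect]
    split_ifs
    · exact zero_le_one
    · calc ∑' c', step O c c' * expect O ψ t c' ≤ ∑' c', step O c c' * 1 :=
            ENNReal.tsum_le_tsum fun c' => mul_le_mul_right (ih c') _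
        _ = 1 := by simp [PMF.tsum_coe]

/-- An average of numbers at most `1` that is `1` has only terms equal to `1`. -/
theorem eq_one_of_one_le_average {α : Type*} (p : PMF α) (f : α → ℝ≥0∞) (hf : ∀ a, f a ≤ 1)
    (h : 1 ≤ ∑' a, p a * f a) {a : α} (ha : a ∈ p.support) : 1 ≤ f a := by
  by_contra hlt
  rw [not_le] at hlt
  have hlt' : ∑' a, p a * f a < ∑' a, p a := by
    refine ENNReal.tsum_lt_tsum (i := a) ?_ (fun b => ?_) ?_
    · exact ((ENNReal.tsum_le_tsum fun b => by
        simpa using mul_le_mul_right (hf b) (p b)).trans_lt (by simp [PMF.tsum_coe])).ne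
    · simpa using mul_le_mul_right (hf b) (p b)
    · have h0 : p a ≠ 0 := (PMF.mem_support_iff _ _).1 ha
      have h1 : p a ≠ ∞ := p.apply_ne_top a
      simpa using (ENNReal.mul_lt_mul_iff_right h0 h1).2 hlt
  rw [PMF.tsum_coe] at hlt'
  exact absurd h (not_le.2 hlt')

/-- Full mass forces every path of positive probability to be a good one. This turns an expectation
into a statement about all paths. -/
theorem halted_of_one_le_expect (hψ : ∀ s, ψ s ≤ 1) {t : ℕ} {c : Cfg}
    (h : 1 ≤ expect O ψ t c) : ∀ c' ∈ (run O t c).support, c'.todo = [] ∧ 1 ≤ ψ c'.store := by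
  induction t generalizing c with
  | zero =>
    intro c' hc'
    obtain rfl : c' = c := by simpa [run] using hc'
    rw [expect] at h
    split_ifs at h with h0
    · exact ⟨h0, h⟩
    · simp at h
  | succ t ih =>
    intro c' hc'
    rw [expect] at h
    split_ifs at h with h0
    · simp at h
    · rw [run, PMF.mem_support_bind_iff] at hc'
      obtain ⟨d, hd, hc'⟩ := hc'
      exact ih (eq_one_of_one_le_average _ _ (expect_le_one hψ t) h hd) c' hc'

theorem not_badQuery_of_one_le_expect (hψ : ∀ s, ψ s ≤ 1) {t : ℕ} {c : Cfg}
    (h : 1 ≤ expect O ψ t c) (t' : ℕ) : ∀ c' ∈ (run O t' c).support, ¬ BadQuery c' := by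
  -- A pending query is inspected only when a step is still available, hence the extra 1 beyond the
  -- `t'` steps of the path.
  have h' : 1 ≤ expect O ψ (t + t' + 1) c := h.trans (expect_mono c (by lia))
  clear h
  induction t' generalizing c with
  | zero =>
    intro c' hc'
    obtain rfl : c' = c := by simpa [run] using hc'
    intro hb
    rw [expect, if_pos hb] at h'
    simp at h'
  | succ t' ih =>
    intro c' hc'
    rw [expect] at h'
    split_ifs at h' with h0
    · simp at h'
    · rw [run, PMF.mem_support_bind_iff] at hc'
      obtain ⟨d, hd, hc'⟩ := hc'
      exact ih (eq_one_of_one_le_average _ _ (expect_le_one hψ _) h' hd) c' hc'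

open Classical in
theorem expect_indicator_le (A : Store → Prop) (t : ℕ) (c : Cfg) :
    expect O (fun s => if A s then 1 else 0) t c ≤
      (run O t c).toOuterMeasure {c' | A c'.store} := by
  induction t generalizing c with
  | zero =>
    rw [expect, run, PMF.toOuterMeasure_pure_apply]
    simp only [Set.mem_ofPred_eq]
    split_ifs <;> simp
  | succ t ih =>
    rw [expect, run, PMF.toOuterMeasure_bind_apply]
    split_ifs
    · simp
    · exact ENNReal.tsum_le_tsum fun c' => mul_le_mul_right (ih c') _

end

/-! ## Deterministic executions -/

/-- The program `P`, started in `s`, ends in `s'` within `t` steps. -/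
def Ends (P : Prog) (s : Store) (t : ℕ) (s' : Store) : Prop :=
  ∀ (O : Oracle) (ψ : Store → ℝ≥0∞) (K : List Prog) (m : ℕ),
    expect O ψ m ⟨K, s'⟩ ≤ expect O ψ (m + t) ⟨P :: K, s⟩

/-- The program `P`, started in `s`, ends within `t` steps in a memory satisfying `Post`. -/
def Reaches (P : Prog) (s : Store) (t : ℕ) (Post : Store → Prop) : Prop :=
  ∃ s', Ends P s t s' ∧ Post s'

theorem Ends.mono {P : Prog} {s s' : Store} {t t' : ℕ} (h : Ends P s t s') (ht : t ≤ t') :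
    Ends P s t' s' := fun O ψ K m => (h O ψ K m).trans (expect_mono _ (by lia))

theorem Ends.skip (s : Store) : Ends .skip s 1 s := fun O ψ K m =>
  (expect_succ_of_step (by simp [BadQuery]) rfl m).ge

theorem Ends.instr (i : Instr) (s : Store) : Ends (.instr i) s 1 (i.exec s) := fun O ψ K m =>
  (expect_succ_of_step (by simp [BadQuery]) rfl m).ge

theorem expect_seq {O : Oracle} {ψ : Store → ℝ≥0∞} (P Q : Prog) (K : List Prog) (s : Store)
    (m : ℕ) : expect O ψ (m + 1) ⟨.seq P Q :: K, s⟩ = expect O ψ m ⟨P :: Q :: K, s⟩ :=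
  expect_succ_of_step (by simp [BadQuery]) rfl m

theorem expect_loop_true {O : Oracle} {ψ : Store → ℝ≥0∞} {b : Test} {s : Store} (hb : b.Holds s)
    (P : Prog) (K : List Prog) (m : ℕ) :
    expect O ψ (m + 1) ⟨.loop b P :: K, s⟩ = expect O ψ m ⟨P :: .loop b P :: K, s⟩ :=
  expect_succ_of_step (by simp [BadQuery]) (by simp [step, hb]) m

theorem expect_loop_false {O : Oracle} {ψ : Store → ℝ≥0∞} {b : Test} {s : Store}
    (hb : ¬ b.Holds s) (P : Prog) (K : List Prog) (m : ℕ) :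
    expect O ψ (m + 1) ⟨.loop b P :: K, s⟩ = expect O ψ m ⟨K, s⟩ :=
  expect_succ_of_step (by simp [BadQuery]) (by simp [step, hb]) m

/-- `Ends` quantifies over the continuation `K` and the remaining time `m`, so composing programs is
transitivity of `≤`. -/
theorem Ends.seq {P Q : Prog} {s s₁ s₂ : Store} {t₁ t₂ : ℕ} (h₁ : Ends P s t₁ s₁)
    (h₂ : Ends Q s₁ t₂ s₂) : Ends (.seq P Q) s (t₁ + t₂ + 1) s₂ := fun O ψ K m => by
  rw [← add_assoc, expect_seq, add_comm t₁, ← add_assoc]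
  exact (h₂ O ψ K m).trans (h₁ O ψ _ _)

theorem Ends.ite_true {b : Test} {P Q : Prog} {s s' : Store} {t : ℕ} (hb : b.Holds s)
    (h : Ends P s t s') : Ends (.ite b P Q) s (t + 1) s' := fun O ψ K m => by
  rw [← add_assoc, expect_succ_of_step (c' := ⟨P :: K, s⟩) (by simp [BadQuery])
    (by simp [step, hb])]
  exact h O ψ K m

theorem Ends.ite_false {b : Test} {P Q : Prog} {s s' : Store} {t : ℕ} (hb : ¬ b.Holds s)
    (h : Ends Q s t s') : Ends (.ite b P Q) s (t + 1) s' := fun O ψ K m => by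
  rw [← add_assoc, expect_succ_of_step (c' := ⟨Q :: K, s⟩) (by simp [BadQuery])
    (by simp [step, hb])]
  exact h O ψ K m

theorem Ends.loop_true {b : Test} {P : Prog} {s s₁ s₂ : Store} {t₁ t₂ : ℕ} (hb : b.Holds s)
    (h₁ : Ends P s t₁ s₁) (h₂ : Ends (.loop b P) s₁ t₂ s₂) :
    Ends (.loop b P) s (t₁ + t₂ + 1) s₂ := fun O ψ K m => by
  rw [← add_assoc, expect_loop_true hb, add_comm t₁, ← add_assoc]
  exact (h₂ O ψ K m).trans (h₁ O ψ _ _)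

theorem Ends.loop_false {b : Test} {P : Prog} {s : Store} (hb : ¬ b.Holds s) :
    Ends (.loop b P) s 1 s := fun _ _ K m => (expect_loop_false hb P K m).ge

theorem Reaches.seq {P Q : Prog} {s : Store} {t₁ t₂ : ℕ} {A B : Store → Prop}
    (h₁ : Reaches P s t₁ A) (h₂ : ∀ s', A s' → Reaches Q s' t₂ B) :
    Reaches (.seq P Q) s (t₁ + t₂ + 1) B := by
  obtain ⟨s₁, h₁, hA⟩ := h₁
  obtain ⟨s₂, h₂, hB⟩ := h₂ s₁ hA
  exact ⟨s₂, h₁.seq h₂, hB⟩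

theorem Reaches.mono {P : Prog} {s : Store} {t t' : ℕ} {A B : Store → Prop}
    (h : Reaches P s t A) (ht : t ≤ t') (hAB : ∀ s', A s' → B s') : Reaches P s t' B := by
  obtain ⟨s₁, h₁, hA⟩ := h
  exact ⟨s₁, h₁.mono ht, hAB _ hA⟩

/-- The indicator of `Post`, with empty continuation and no remaining time, has expectation 1. -/
theorem Reaches.haltsWithin {P : Prog} {s : Store} {t : ℕ} {Post : Store → Prop}
    (h : Reaches P s t Post) (O : Oracle) : HaltsWithin O P s t Post := by
  classical
  obtain ⟨s', h, hs'⟩ := h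
  intro c hc
  have h1 := h O (fun s => if Post s then 1 else 0) [] 0
  rw [expect_halted, if_pos hs', zero_add] at h1
  obtain ⟨h2, h3⟩ := halted_of_one_le_expect (fun s => by split_ifs <;> simp) h1 c hc
  refine ⟨h2, ?_⟩
  by_contra hn
  simp [hn] at h3

/-! ### Programs without loops -/

/-- Programs without loops, coin flips and oracle calls. -/
def Prog.Straight : Prog → Prop
  | .skip => True
  | .instr _ => True
  | .flip _ => False
  | .query _ _ _ => False
  | .seq P Q => P.Straight ∧ Q.Straight
  | .ite _ P Q => P.Straight ∧ Q.Straight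
  | .loop _ _ => False

open Classical in
/-- The effect of a program without loops. -/
def Prog.effect : Prog → Store → Store
  | .skip, s => s
  | .instr i, s => i.exec s
  | .flip _, s => s
  | .query _ _ _, s => s
  | .seq P Q, s => Q.effect (P.effect s)
  | .ite t P Q, s => if t.Holds s then P.effect s else Q.effect s
  | .loop _ _, s => s

/-- The number of nodes of a program. -/
def Prog.nodes : Prog → ℕ
  | .skip => 1
  | .instr _ => 1
  | .flip _ => 1
  | .query _ _ _ => 1
  | .seq P Q => P.nodes + Q.nodes + 1
  | .ite _ P Q => P.nodes + Q.nodes + 1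
  | .loop _ P => P.nodes + 1

/-- Each node is visited at most once, so its count bounds the time. Loop bodies are thereby handled
by simplifying `Prog.effect`. -/
theorem Prog.Straight.ends {P : Prog} (hP : P.Straight) (s : Store) :
    Ends P s P.nodes (P.effect s) := by
  induction P generalizing s with
  | skip => exact Ends.skip s
  | instr i => exact Ends.instr i s
  | flip r => exact hP.elim
  | query k d a => exact hP.elim
  | seq P Q ihP ihQ => exact (ihP hP.1 s).seq (ihQ hP.2 _)
  | ite t P Q ihP ihQ =>
    by_cases h : t.Holds s
    · simpa [Prog.effect, h] using (Ends.ite_true h (ihP hP.1 s)).mono (by simp [Prog.nodes])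
    · simpa [Prog.effect, h] using (Ends.ite_false h (ihQ hP.2 s)).mono (by simp [Prog.nodes])
  | loop t P => exact hP.elim

/-- Sequential composition of a list of programs. -/
def block : List Prog → Prog
  | [] => .skip
  | P :: l => .seq P (block l)

/-! ## Moving stacks

Register `13` is scratch; registers `14` and `15` hold the constants `0` and `1`. -/

/-- Move the contents of stack `a` onto stack `b`, in reverse order. -/
def moveAll (a b : ℕ) : Prog :=
  .loop (.neg (.empty a)) (.seq (.instr (.pop 13 a)) (.instr (.push b 13)))

theorem moveAll_reaches {a b : ℕ} (hab : a ≠ b) (s : Store) :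
    Reaches (moveAll a b) s (4 * (s.stk a).length + 1) fun s' =>
      (∀ r, r ≠ 13 → s'.reg r = s.reg r) ∧ s'.stk a = [] ∧
      s'.stk b = (s.stk a).reverse ++ s.stk b ∧ ∀ k, k ≠ a → k ≠ b → s'.stk k = s.stk k := by
  generalize hl : s.stk a = l
  induction l generalizing s with
  | nil =>
    refine ⟨s, (Ends.loop_false (by simp [Test.Holds, hl])).mono (by simp), ?_⟩
    simp [hl]
  | cons x l ih =>
    set B : Prog := .seq (.instr (.pop 13 a)) (.instr (.push b 13)) with hB
    have hS : B.Straight := ⟨trivial, trivial⟩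
    have ha : (B.effect s).stk a = l := by
      simp [hB, Prog.effect, Instr.exec, hab, hl]
    have hb : (B.effect s).stk b = x :: s.stk b := by
      simp [hB, Prog.effect, Instr.exec, hab.symm, hl]
    obtain ⟨s', h, h1, h2, h3, h4⟩ := ih (B.effect s) ha
    refine ⟨s', ((hS.ends s).loop_true (by simp [Test.Holds, hl]) h).mono ?_, ?_, h2, ?_, ?_⟩
    · have : B.nodes = 3 := rfl
      simp only [List.length_cons]
      lia
    · intro r hr
      rw [h1 r hr]
      simp [hB, Prog.effect, Instr.exec, hr]
    · simp [h3, hb]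
    · intro k hka hkb
      rw [h4 k hka hkb]
      simp [hB, Prog.effect, Instr.exec, hka, hkb]

/-! ## The evaluation machine

A word is read from left to right against an assignment.  Its negative entries describe parity
checks: `-(i + 1)` adds variable `i` to the current check, and `-1 / 2` closes the check.  Its
nonnegative entries are a list of applications of constraints. -/

/-- The entry of a list at position `u`, with default value `b`. -/
def pick : List ℝ → ℝ → ℝ → ℝ
  | [], _, b => b
  | x :: B, u, b => pick B (u - 1) (if u = 0 then x else b)

/-- The state of the evaluation machine: the numbers of argument indices and of table entries
still to be read, the distance to the entry to be selected, the product of the selected entries,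
the sign of the current parity check, `2` to the number of checks passed before the first failure,
and whether no check has failed. -/
@[ext]
structure EvalState where
  pending : ℝ
  left : ℝ
  index : ℝ
  value : ℝ
  sign : ℝ
  level : ℝ
  alive : ℝ

/-- The state at the start. -/
def EvalState.init : EvalState := ⟨0, 0, 0, 1, 1, 1, 1⟩

/-- The position of the assignment that the entry `v` refers to. -/
def position (v : ℝ) : ℝ := if 0 ≤ v then v else -1 - v

open Classical in
/-- The effect of reading the entry `v` if it refers to a variable of value `b`. -/
def EvalState.read (b v : ℝ) (σ : EvalState) : EvalState :=
  if 0 ≤ v then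
    if σ.left ≤ 0 then { σ with pending := v, index := 0, left := 1 }
    else if 1 ≤ σ.pending then
      { σ with index := σ.index + σ.index + b, left := σ.left + σ.left, pending := σ.pending - 1 }
    else
      { σ with
        value := if σ.index = 0 then σ.value * v else σ.value
        index := σ.index - 1
        left := σ.left - 1 }
  else if 0 ≤ position v then { σ with sign := σ.sign * (1 - (b + b)) }
  else if 1 ≤ σ.alive ∧ 1 ≤ σ.sign then { σ with level := σ.level + σ.level, sign := 1 }
  else { σ with alive := 0, sign := 1 }

/-- The state after reading a word against the assignment `B`. -/
def evalWord (B : List ℝ) (w : List ℝ) (σ : EvalState) : EvalState :=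
  w.foldl (fun σ v => σ.read (pick B (position v) 0) v) σ

/-- The state of the evaluation machine that the registers `1` to `7` describe. -/
def EvalState.of (s : Store) : EvalState :=
  ⟨s.reg 1, s.reg 2, s.reg 3, s.reg 4, s.reg 5, s.reg 6, s.reg 7⟩

/-- The machine only tests `≤`, so the nested tests express that register 12 is 0. Stack 3 keeps the
entries read, so that `pickProg` can restore stack 2. -/
def pickBody : Prog :=
  block [.instr (.pop 13 2), .instr (.push 3 13),
    .ite (.le 12 14) (.ite (.le 14 12) (.instr (.copy 11 13)) .skip) .skip,
    .instr (.sub 12 12 15)]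

/-- Put the entry of stack `2` at the position in register `12` into register `11`. -/
def pickProg : Prog := .seq (.loop (.neg (.empty 2)) pickBody) (moveAll 3 2)

theorem pickLoop_reaches (s : Store) (h0 : s.reg 14 = 0) (h1 : s.reg 15 = 1) :
    Reaches (.loop (.neg (.empty 2)) pickBody) s (14 * (s.stk 2).length + 1) fun s' =>
      (∀ r, r ≠ 11 → r ≠ 12 → r ≠ 13 → s'.reg r = s.reg r) ∧
      s'.reg 11 = pick (s.stk 2) (s.reg 12) (s.reg 11) ∧
      s'.stk 2 = [] ∧ s'.stk 3 = (s.stk 2).reverse ++ s.stk 3 ∧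
      ∀ k, k ≠ 2 → k ≠ 3 → s'.stk k = s.stk k := by
  generalize hl : s.stk 2 = l
  induction l generalizing s with
  | nil =>
    refine ⟨s, (Ends.loop_false (by simp [Test.Holds, hl])).mono (by simp), ?_⟩
    simp [hl, pick]
  | cons x l ih =>
    have hS : pickBody.Straight := by simp [pickBody, block, Prog.Straight]
    have hE : pickBody.effect s =
        ⟨Function.update (Function.update (Function.update s.reg 13 x) 11
          (if s.reg 12 = 0 then x else s.reg 11)) 12 (s.reg 12 - 1),
         Function.update (Function.update s.stk 2 l) 3 (x :: s.stk 3)⟩ := by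
      rcases lt_trichotomy (s.reg 12) 0 with h | h | h
      · have : ¬ 0 ≤ s.reg 12 := by linarith
        simp [pickBody, block, Prog.effect, Instr.exec, Test.Holds, hl, h0, h1, h.ne, h.le, this,
          ← Function.update_comm (show (11 : ℕ) ≠ 13 by decide)]
      · simp [pickBody, block, Prog.effect, Instr.exec, Test.Holds, hl, h0, h1, h]
      · have : ¬ s.reg 12 ≤ 0 := by linarith
        simp [pickBody, block, Prog.effect, Instr.exec, Test.Holds, hl, h0, h1, h.ne', this,
          ← Function.update_comm (show (11 : ℕ) ≠ 13 by decide)]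
    obtain ⟨s', h, g1, g2, g3, g4, g5⟩ := ih (pickBody.effect s) (by simp [hE, h0])
      (by simp [hE, h1]) (by simp [hE])
    refine ⟨s', ((hS.ends s).loop_true (by simp [Test.Holds, hl]) h).mono ?_, ?_, ?_, g3, ?_, ?_⟩
    · have : pickBody.nodes = 13 := rfl
      simp only [List.length_cons]
      lia
    · intro r a b c
      rw [g1 r a b c]
      simp [hE, a, b, c]
    · simp [g2, hE, pick]
    · simp [g4, hE]
    · intro k a b
      rw [g5 k a b]
      simp [hE, a, b]

theorem pickProg_reaches (s : Store) (h0 : s.reg 14 = 0) (h1 : s.reg 15 = 1)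
    (h3 : s.stk 3 = []) :
    Reaches pickProg s (18 * (s.stk 2).length + 3) fun s' =>
      (∀ r, r ≠ 11 → r ≠ 12 → r ≠ 13 → s'.reg r = s.reg r) ∧
      s'.reg 11 = pick (s.stk 2) (s.reg 12) (s.reg 11) ∧ s'.stk = s.stk := by
  refine ((pickLoop_reaches s h0 h1).seq (t₂ := 4 * (s.stk 2).length + 1)
    (B := fun s' => (∀ r, r ≠ 11 → r ≠ 12 → r ≠ 13 → s'.reg r = s.reg r) ∧
      s'.reg 11 = pick (s.stk 2) (s.reg 12) (s.reg 11) ∧ s'.stk = s.stk) ?_).mono (by lia)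
    fun _ h => h
  rintro s' ⟨a1, a2, a3, a4, a5⟩
  refine (moveAll_reaches (by decide) s').mono (by simp [a4, h3]) ?_
  rintro s'' ⟨b1, b2, b3, b4⟩
  refine ⟨fun r p q u => by rw [b1 r u, a1 r p q u], by rw [b1 11 (by decide), a2], ?_⟩
  funext k
  by_cases k2 : k = 2
  · subst k2
    simp [b3, a3, a4, h3]
  · by_cases k3 : k = 3
    · subst k3
      rw [b2, h3]
    · rw [b4 k k3 k2, a5 k k2 k3]

/-- The position is stored twice: `pickProg` consumes register 12, while `readProg` branches on
register 10. -/
def fetchProg : Prog :=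
  block [.instr (.pop 9 0), .instr (.push 4 9),
    .ite (.le 14 9) (.instr (.copy 10 9)) (.seq (.instr (.const 10 (-1))) (.instr (.sub 10 10 9))),
    .instr (.copy 12 10), .instr (.const 11 0)]

def readProg : Prog :=
  .ite (.le 14 9)
    (.ite (.le 2 14)
      (block [.instr (.copy 1 9), .instr (.const 3 0), .instr (.const 2 1)])
      (.ite (.le 15 1)
        (block [.instr (.add 3 3 3), .instr (.add 3 3 11), .instr (.add 2 2 2),
          .instr (.sub 1 1 15)])
        (block [.ite (.le 3 14) (.ite (.le 14 3) (.instr (.mul 4 4 9)) .skip) .skip,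
          .instr (.sub 3 3 15), .instr (.sub 2 2 15)])))
    (.ite (.le 14 10)
      (block [.instr (.add 13 11 11), .instr (.sub 13 15 13), .instr (.mul 5 5 13)])
      (block [.ite (.le 15 7) (.ite (.le 15 5) (.instr (.add 6 6 6)) (.instr (.const 7 0)))
          (.instr (.const 7 0)), .instr (.const 5 1)]))

def evalBody : Prog := .seq fetchProg (.seq pickProg readProg)

/-- Read the word on stack `0` against the assignment on stack `2`, moving it to stack `4`. -/
def evalLoop : Prog := .loop (.neg (.empty 0)) evalBody

theorem fetchProg_effect (s : Store) (h0 : s.reg 14 = 0) {v : ℝ} {l : List ℝ}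
    (hl : s.stk 0 = v :: l) :
    ((∀ r, r < 9 ∨ 14 ≤ r → (fetchProg.effect s).reg r = s.reg r) ∧
      (fetchProg.effect s).reg 9 = v ∧ (fetchProg.effect s).reg 10 = position v ∧
      (fetchProg.effect s).reg 12 = position v ∧ (fetchProg.effect s).reg 11 = 0) ∧
    (fetchProg.effect s).stk 0 = l ∧ (fetchProg.effect s).stk 4 = v :: s.stk 4 ∧
    ∀ k, k ≠ 0 → k ≠ 4 → (fetchProg.effect s).stk k = s.stk k := by
  have hr : ∀ r, r < 9 ∨ 14 ≤ r → r ≠ 9 ∧ r ≠ 10 ∧ r ≠ 11 ∧ r ≠ 12 := fun r hr => by lia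
  by_cases hv : 0 ≤ v
  · simp +contextual [fetchProg, block, Prog.effect, Instr.exec, Test.Holds, hl, h0, hv, position,
      hr]
  · simp +contextual [fetchProg, block, Prog.effect, Instr.exec, Test.Holds, hl, h0, hv, position,
      hr]

/-- The branches of `readProg` are those of `EvalState.read`; the trichotomy on register 3 covers
the equality test made of two comparisons. -/
theorem readProg_effect (s : Store) (h0 : s.reg 14 = 0) (h1 : s.reg 15 = 1)
    (h10 : s.reg 10 = position (s.reg 9)) :
    (∀ r, 8 ≤ r → r ≠ 13 → (readProg.effect s).reg r = s.reg r) ∧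
    EvalState.of (readProg.effect s) = (EvalState.of s).read (s.reg 11) (s.reg 9) ∧
    (readProg.effect s).stk = s.stk := by
  have hr : ∀ r, 8 ≤ r → r ≠ 1 ∧ r ≠ 2 ∧ r ≠ 3 ∧ r ≠ 4 ∧ r ≠ 5 ∧ r ≠ 6 ∧ r ≠ 7 :=
    fun r hr => by lia
  by_cases hv : 0 ≤ s.reg 9
  · by_cases h2 : s.reg 2 ≤ 0
    · simp +contextual [readProg, block, Prog.effect, Instr.exec, Test.Holds, h0, hv, h2, hr,
        EvalState.of, EvalState.read]
    · by_cases h3 : 1 ≤ s.reg 1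
      · simp +contextual [readProg, block, Prog.effect, Instr.exec, Test.Holds, h0, h1, hv, h2, h3,
          hr, EvalState.of, EvalState.read]
      · rcases lt_trichotomy (s.reg 3) 0 with h | h | h
        · have : ¬ 0 ≤ s.reg 3 := by linarith
          simp +contextual [readProg, block, Prog.effect, Instr.exec, Test.Holds, h0, h1, hv, h2,
            h3, hr, EvalState.of, EvalState.read, h.ne, h.le, this]
        · simp +contextual [readProg, block, Prog.effect, Instr.exec, Test.Holds, h0, h1, hv, h2,
            h3, hr, EvalState.of, EvalState.read, h]
        · have : ¬ s.reg 3 ≤ 0 := by linarith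
          simp +contextual [readProg, block, Prog.effect, Instr.exec, Test.Holds, h0, h1, hv, h2,
            h3, hr, EvalState.of, EvalState.read, h.ne', this]
  · by_cases hu : 0 ≤ position (s.reg 9)
    · simp +contextual [readProg, block, Prog.effect, Instr.exec, Test.Holds, h0, h1, hv, h10, hu,
        hr, EvalState.of, EvalState.read]
    · by_cases h7 : 1 ≤ s.reg 7 <;> by_cases h5 : 1 ≤ s.reg 5 <;>
      simp +contextual [readProg, block, Prog.effect, Instr.exec, Test.Holds, h0, h1, hv, h10, hu,
        hr, EvalState.of, EvalState.read, h7, h5]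

theorem evalBody_reaches (s : Store) (h0 : s.reg 14 = 0) (h1 : s.reg 15 = 1)
    (h3 : s.stk 3 = []) {v : ℝ} {l : List ℝ} (hl : s.stk 0 = v :: l) :
    Reaches evalBody s (18 * (s.stk 2).length + 80) fun s' =>
      (∀ r, r = 8 ∨ 14 ≤ r → s'.reg r = s.reg r) ∧
      EvalState.of s' = (EvalState.of s).read (pick (s.stk 2) (position v) 0) v ∧
      s'.stk 0 = l ∧ s'.stk 4 = v :: s.stk 4 ∧ ∀ k, k ≠ 0 → k ≠ 4 → s'.stk k = s.stk k := by
  have hf : fetchProg.Straight := by simp [fetchProg, block, Prog.Straight]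
  have hr : readProg.Straight := by simp [readProg, block, Prog.Straight]
  obtain ⟨⟨a1, a2, a3, a4, a5⟩, a6, a7, a8⟩ := fetchProg_effect s h0 hl
  have hend := hf.ends s
  set s₁ := fetchProg.effect s
  obtain ⟨s₂, hp, b1, b2, b3⟩ := pickProg_reaches s₁ (by rw [a1 14 (by simp), h0])
    (by rw [a1 15 (by simp), h1]) (by rw [a8 3 (by simp) (by simp), h3])
  obtain ⟨c1, c2, c3⟩ := readProg_effect s₂
    (by rw [b1 14 (by simp) (by simp) (by simp), a1 14 (by simp), h0])
    (by rw [b1 15 (by simp) (by simp) (by simp), a1 15 (by simp), h1])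
    (by rw [b1 10 (by simp) (by simp) (by simp), b1 9 (by simp) (by simp) (by simp), a2, a3])
  refine ⟨readProg.effect s₂, (hend.seq (hp.seq (hr.ends s₂))).mono ?_, ?_, ?_, ?_, ?_, ?_⟩
  · rw [a8 2 (by simp) (by simp)]
    have : fetchProg.nodes + readProg.nodes ≤ 75 := by
      simp [fetchProg, readProg, block, Prog.nodes]
    lia
  · intro r hr
    rw [c1 r (by lia) (by lia), b1 r (by lia) (by lia) (by lia), a1 r (by lia)]
  · have e : EvalState.of s₂ = EvalState.of s := by
      simp [EvalState.of, b1, a1]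
    rw [c2, e, b2, b1 9 (by simp) (by simp) (by simp), a2, a4, a5, a8 2 (by simp) (by simp)]
  · rw [c3, b3, a6]
  · rw [c3, b3, a7]
  · intro k k0 k4
    rw [c3, b3, a8 k k0 k4]

theorem evalLoop_reaches (s : Store) (h0 : s.reg 14 = 0) (h1 : s.reg 15 = 1)
    (h3 : s.stk 3 = []) :
    Reaches evalLoop s ((18 * (s.stk 2).length + 81) * (s.stk 0).length + 1) fun s' =>
      (∀ r, r = 8 ∨ 14 ≤ r → s'.reg r = s.reg r) ∧
      EvalState.of s' = evalWord (s.stk 2) (s.stk 0) (EvalState.of s) ∧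
      s'.stk 0 = [] ∧ s'.stk 4 = (s.stk 0).reverse ++ s.stk 4 ∧
      ∀ k, k ≠ 0 → k ≠ 4 → s'.stk k = s.stk k := by
  generalize hl : s.stk 0 = l
  induction l generalizing s with
  | nil =>
    refine ⟨s, (Ends.loop_false (by simp [Test.Holds, hl])).mono (by simp), ?_⟩
    simp [hl, evalWord]
  | cons x l ih =>
    obtain ⟨s₁, hb, a1, a2, a3, a4, a5⟩ := evalBody_reaches s h0 h1 h3 hl
    obtain ⟨s₂, h, b1, b2, b3, b4, b5⟩ := ih s₁ (by rw [a1 14 (by simp), h0])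
      (by rw [a1 15 (by simp), h1]) (by rw [a5 3 (by simp) (by simp), h3]) a3
    refine ⟨s₂, (hb.loop_true (by simp [Test.Holds, hl]) h).mono ?_, ?_, ?_, b3, ?_, ?_⟩
    · rw [a5 2 (by simp) (by simp), List.length_cons]
      lia
    · intro r hr
      rw [b1 r hr, a1 r hr]
    · rw [b2, a2, a5 2 (by simp) (by simp)]
      simp [evalWord]
    · simp [b4, a4]
    · intro k k0 k4
      rw [b5 k k0 k4, a5 k k0 k4]

/-- Prepare the evaluation machine. -/
def initProg : Prog :=
  block [.instr (.const 1 0), .instr (.const 2 0), .instr (.const 3 0), .instr (.const 4 1),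
    .instr (.const 5 1), .instr (.const 6 1), .instr (.const 7 1)]

theorem initProg_effect (s : Store) :
    (∀ r, 8 ≤ r → (initProg.effect s).reg r = s.reg r) ∧
    EvalState.of (initProg.effect s) = .init ∧ (initProg.effect s).stk = s.stk := by
  have hr : ∀ r, 8 ≤ r → r ≠ 1 ∧ r ≠ 2 ∧ r ≠ 3 ∧ r ≠ 4 ∧ r ≠ 5 ∧ r ≠ 6 ∧ r ≠ 7 :=
    fun r hr => by lia
  simp +contextual [initProg, block, Prog.effect, Instr.exec, hr, EvalState.of, EvalState.init]

/-- Evaluate the word on stack `0` against the assignment on stack `2`. -/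
def evalProg : Prog := .seq initProg evalLoop

theorem evalProg_reaches (s : Store) (h0 : s.reg 14 = 0) (h1 : s.reg 15 = 1)
    (h3 : s.stk 3 = []) :
    Reaches evalProg s ((18 * (s.stk 2).length + 81) * (s.stk 0).length + 17) fun s' =>
      (∀ r, r = 8 ∨ 14 ≤ r → s'.reg r = s.reg r) ∧
      EvalState.of s' = evalWord (s.stk 2) (s.stk 0) .init ∧
      s'.stk 0 = [] ∧ s'.stk 4 = (s.stk 0).reverse ++ s.stk 4 ∧
      ∀ k, k ≠ 0 → k ≠ 4 → s'.stk k = s.stk k := by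
  have hi : initProg.Straight := by simp [initProg, block, Prog.Straight]
  obtain ⟨a1, a2, a3⟩ := initProg_effect s
  obtain ⟨s', h, b1, b2, b3, b4, b5⟩ := evalLoop_reaches (initProg.effect s)
    (by rw [a1 14 (by simp), h0]) (by rw [a1 15 (by simp), h1]) (by rw [a3, h3])
  rw [a3] at h b2 b4 b5
  rw [a2] at b2
  refine ⟨s', ((hi.ends s).seq h).mono ?_, fun r hr => ?_, b2, b3, b4, b5⟩
  · have : initProg.nodes = 15 := rfl
    lia
  · rw [b1 r hr, a1 r (by lia)]

/-! ## The target problem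

An instance is a word consisting of a threshold and a word for the evaluation machine.  An
assignment whose value does not exceed the threshold has measure `1`; the other ones are rated by
the number of parity checks that they pass before their first failure. -/

open Classical in
/-- The measure of the assignment `B` for the instance `w`. -/
def score (w B : List ℝ) : ℝ :=
  if (evalWord B w.tail .init).value ≤ w.headD 0 then 1
  else (evalWord B w.tail .init).level + (evalWord B w.tail .init).level

theorem EvalState.read_level (b v : ℝ) (σ : EvalState) :
    (σ.read b v).level = σ.level ∨ (σ.read b v).level = σ.level + σ.level := by
  unfold EvalState.read
  split_ifs <;> simp

/-- One entry at most doubles the level and never lowers it. No well-formedness of the word is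
needed, which is why all words can be instances. -/
theorem evalWord_level (B w : List ℝ) (σ : EvalState) (h : 1 ≤ σ.level) :
    1 ≤ (evalWord B w σ).level ∧ (evalWord B w σ).level ≤ 2 ^ w.length * σ.level := by
  induction w generalizing σ with
  | nil => simpa [evalWord] using h
  | cons v w ih =>
    have hs := σ.read_level (pick B (position v) 0) v
    obtain ⟨h1, h2⟩ := ih (σ.read (pick B (position v) 0) v) (by
      rcases hs with hs | hs <;> rw [hs] <;> linarith)
    refine ⟨h1, h2.trans ?_⟩
    rw [List.length_cons, pow_succ, mul_assoc]
    refine mul_le_mul_of_nonneg_left ?_ (by positivity)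
    rcases hs with hs | hs <;> rw [hs] <;> linarith

theorem score_bounds (w B : List ℝ) : 1 ≤ score w B ∧ score w B ≤ 2 ^ (w.length + 1) := by
  obtain ⟨h1, h2⟩ := evalWord_level B w.tail .init (by simp [EvalState.init])
  have h3 : (2 : ℝ) ^ w.tail.length ≤ 2 ^ w.length :=
    pow_le_pow_right₀ (by norm_num) (by simp)
  have h4 : (1 : ℝ) ≤ 2 ^ (w.length + 1) := one_le_pow₀ (by norm_num)
  rw [EvalState.init, mul_one] at h2
  unfold score
  split_ifs
  · exact ⟨le_rfl, h4⟩
  · rw [EvalState.init] at *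
    rw [pow_succ]
    constructor <;> linarith

/-- The problem of improving an assignment, subject to parity checks. -/
def improvement : OptProblem where
  Inst := List ℝ
  encode := id
  encode_injective := Function.injective_id
  sol := fun w => {y | y.length ≤ w.length}
  measure := fun w y => (score w (bits y)).toNNReal
  goal := .maximize

theorem coe_measure_improvement (w : improvement.Inst) (y : List Bool) :
    (improvement.measure w y : ℝ) = score w (bits y) :=
  Real.coe_toNNReal _ (zero_le_one.trans (score_bounds w _).1)

/-! ### Recognizing solutions -/

/-- Both stacks are popped in parallel; register 2 records that stack 0 ran out first. -/
def compareBody : Prog :=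
  block [.ite (.empty 0) (.instr (.const 2 1)) .skip, .instr (.pop 3 0), .instr (.pop 3 1)]

/-- Compare the lengths of the words on the stacks `0` and `1`. -/
def compareProg : Prog :=
  .seq (.loop (.neg (.empty 1)) compareBody) (.seq (.instr (.const 4 1)) (.instr (.sub 0 4 2)))

theorem compareLoop_reaches (s : Store) :
    Reaches (.loop (.neg (.empty 1)) compareBody) s (10 * (s.stk 1).length + 1) fun s' =>
      s'.reg 2 = if (s.stk 1).length ≤ (s.stk 0).length then s.reg 2 else 1 := by
  generalize hl : s.stk 1 = l
  induction l generalizing s with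
  | nil =>
    exact ⟨s, (Ends.loop_false (by simp [Test.Holds, hl])).mono (by simp), by simp⟩
  | cons x l ih =>
    have hS : compareBody.Straight := by simp [compareBody, block, Prog.Straight]
    have hl' : (compareBody.effect s).stk 1 = l := by
      by_cases h : s.stk 0 = [] <;>
        simp [compareBody, block, Prog.effect, Instr.exec, Test.Holds, hl, h]
    obtain ⟨s', h, g⟩ := ih (compareBody.effect s) hl'
    refine ⟨s', ((hS.ends s).loop_true (by simp [Test.Holds, hl]) h).mono ?_, ?_⟩
    · have : compareBody.nodes = 9 := rfl
      simp only [List.length_cons]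
      lia
    · refine g.trans ?_
      cases h0 : s.stk 0 with
      | nil => simp [compareBody, block, Prog.effect, Instr.exec, Test.Holds, h0]
      | cons z l0 => simp [compareBody, block, Prog.effect, Instr.exec, Test.Holds, h0]

theorem compareProg_reaches (w y : List ℝ) :
    Reaches compareProg (load w y 0) (10 * y.length + 5) fun s =>
      s.reg 0 = 1 ↔ y.length ≤ w.length := by
  obtain ⟨s', h, g⟩ := compareLoop_reaches (load w y 0)
  refine ⟨_, (h.seq ((Ends.instr _ _).seq (Ends.instr _ _))).mono ?_, ?_⟩
  · simp [load]
  · by_cases hy : y.length ≤ w.length <;> simp [Instr.exec, g, load, hy]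

/-! ### Computing the measure -/

def setupProg : Prog := block [.instr (.const 14 0), .instr (.const 15 1), .instr (.pop 8 0)]

def resultProg : Prog := .ite (.le 4 8) (.instr (.copy 0 15)) (.instr (.add 0 6 6))

/-- Compute the measure of the assignment on stack `1` for the instance on stack `0`. -/
def scoreProg : Prog :=
  block [setupProg, moveAll 1 3, moveAll 3 2, evalProg, resultProg]

theorem scoreProg_reaches (w y : List ℝ) :
    Reaches scoreProg (load w y 0) ((18 * y.length + 81) * w.length + 8 * y.length + 50) fun s =>
      s.reg 0 = score w y := by
  have hS : setupProg.Straight := by simp [setupProg, block, Prog.Straight]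
  have hR : resultProg.Straight := by simp [resultProg, Prog.Straight]
  have e0 := hS.ends (load w y 0)
  have a : ∀ r, r = 14 ∨ r = 15 ∨ r = 8 → (setupProg.effect (load w y 0)).reg r =
      if r = 15 then 1 else if r = 8 then w.headD 0 else 0 := by
    rintro r (rfl | rfl | rfl) <;> simp [setupProg, block, Prog.effect, Instr.exec, load]
  have b : ∀ k, (setupProg.effect (load w y 0)).stk k =
      if k = 0 then w.tail else if k = 1 then y else [] := by
    intro k
    by_cases hk : k = 0
    · subst hk; simp [setupProg, block, Prog.effect, Instr.exec, load]
    · simp [setupProg, block, Prog.effect, Instr.exec, load, hk]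
  set s₀ := setupProg.effect (load w y 0)
  obtain ⟨s₁, e1, c1, c2, c3, c4⟩ := moveAll_reaches (a := 1) (b := 3) (by decide) s₀
  obtain ⟨s₂, e2, d1, d2, d3, d4⟩ := moveAll_reaches (a := 3) (b := 2) (by decide) s₁
  have hr : ∀ r, r = 14 ∨ r = 15 ∨ r = 8 → s₂.reg r =
      if r = 15 then 1 else if r = 8 then w.headD 0 else 0 := fun r hr => by
    rw [d1 r (by lia), c1 r (by lia), a r hr]
  have h2 : s₂.stk 2 = y := by
    rw [d3, c3, c4 2 (by simp) (by simp), b, b, b]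
    simp
  have h0 : s₂.stk 0 = w.tail := by
    rw [d4 0 (by simp) (by simp), c4 0 (by simp) (by simp), b]
    simp
  obtain ⟨s₃, e3, f1, f2, -⟩ := evalProg_reaches s₂ (by simp [hr]) (by simp [hr]) d2
  rw [h2, h0] at e3 f2
  refine ⟨_, (e0.seq (e1.seq (e2.seq (e3.seq ((hR.ends s₃).seq (Ends.skip _)))))).mono ?_, ?_⟩
  · have h3 : (s₁.stk 3).length = y.length := by
      rw [c3, b, b]
      simp
    have h4 : (s₀.stk 1).length = y.length := by
      rw [b]
      simp
    have h5 : setupProg.nodes = 7 := rfl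
    have h6 : resultProg.nodes = 3 := rfl
    rw [h3, h4, h5, h6]
    have : (18 * y.length + 81) * w.tail.length ≤ (18 * y.length + 81) * w.length :=
      Nat.mul_le_mul_left _ (by simp)
    lia
  · have g4 : s₃.reg 4 = (evalWord y w.tail .init).value := by rw [← f2]; rfl
    have g6 : s₃.reg 6 = (evalWord y w.tail .init).level := by rw [← f2]; rfl
    have g8 : s₃.reg 8 = w.headD 0 := by rw [f1 8 (by simp), hr 8 (by simp)]; simp
    have g15 : s₃.reg 15 = 1 := by rw [f1 15 (by simp), hr 15 (by simp)]; simp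
    by_cases h : (evalWord y w.tail .init).value ≤ w.headD 0
    · simp only [resultProg, Prog.effect, Test.Holds, Instr.exec, g4, g8, g15, score, h, if_true,
        Function.update_self]
    · simp only [resultProg, Prog.effect, Test.Holds, Instr.exec, g4, g8, g6, score, h, if_false,
        Function.update_self]

/-- Every word is an instance, so a program that always accepts recognizes the instances. -/
theorem improvement_inNPO : improvement.InNPO where
  inst_rec := ⟨.instr (.const 0 1), trivial, 1, fun w =>
    Reaches.haltsWithin ⟨_, (Ends.instr _ _).mono (by simp), by
      simp [Instr.exec, improvement]⟩ _⟩
  sol_rec := by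
    refine ⟨compareProg, by simp [compareProg, compareBody, block, Prog.Deterministic],
      10 * Polynomial.X + 5, fun w y => ?_⟩
    refine ((compareProg_reaches w (bits y)).mono ?_ ?_).haltsWithin _
    · simp [bits, OptProblem.size]
    · simp [bits, improvement]
  sol_bound := ⟨Polynomial.X, fun w y hy => by rw [Polynomial.eval_X]; exact hy⟩
  measure_comp := by
    refine ⟨scoreProg, ?_, 18 * Polynomial.X ^ 2 + 89 * Polynomial.X + 50, fun w y _ => ?_⟩
    · simp [scoreProg, setupProg, resultProg, evalProg, initProg, evalLoop, evalBody, fetchProg,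
        pickProg, pickBody, readProg, moveAll, block, Prog.Deterministic]
    · refine ((scoreProg_reaches w (bits y)).mono ?_ ?_).haltsWithin _
      · have h1 : improvement.size w = w.length := rfl
        simp only [h1, bits, List.length_map, Polynomial.eval_add, Polynomial.eval_mul,
          Polynomial.eval_pow, Polynomial.eval_X, Polynomial.eval_ofNat]
        nlinarith [Nat.zero_le (w.length * y.length), Nat.zero_le (w.length ^ 2),
          Nat.zero_le (y.length ^ 2)]
      · intro s hs
        exact hs.trans (coe_measure_improvement w y).symm

theorem improvement_exists_isOptimal (w : List ℝ) : ∃ z, improvement.IsOptimal w z := by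
  have hfin : (improvement.sol w).Finite := List.finite_length_le Bool w.length
  obtain ⟨z, hz, hmax⟩ := hfin.exists_maximalFor (improvement.measure w) _
    ⟨[], show [].length ≤ w.length by simp⟩
  exact ⟨z, hz, fun y hy => (le_total _ _).elim id fun h => hmax hy h⟩

/-- Scores are at least 1, so the case of a zero optimum never arises and the ratio can be cleared.
-/
theorem score_le_of_isApprox {w : improvement.Inst} {r : ℝ} {y z : List Bool}
    (h : improvement.IsApprox r w y) (hz : z.length ≤ List.length w) :
    score w (bits z) ≤ score w (bits y) * r := by
  obtain ⟨-, x, ⟨-, hopt⟩, -, hx⟩ := h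
  have h1 := hopt z hz
  rw [← NNReal.coe_le_coe, coe_measure_improvement, coe_measure_improvement] at h1
  have hxpos := (score_bounds w (bits x)).1
  have hypos := (score_bounds w (bits y)).1
  have h2 := (hx (by
    rw [← NNReal.coe_ne_zero, coe_measure_improvement]
    exact (zero_lt_one.trans_le hxpos).ne')).2
  have h3 := (hx (by
    rw [← NNReal.coe_ne_zero, coe_measure_improvement]
    exact (zero_lt_one.trans_le hxpos).ne')).1
  rw [coe_measure_improvement, coe_measure_improvement, abs_of_nonneg (by positivity)] at h2 h3
  have hr : 0 < r := lt_of_lt_of_le (by positivity) h2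
  rw [div_le_div_iff₀ hr (by positivity), one_mul] at h3
  exact h1.trans h3

/-- The empty word is always a solution, and by `score_bounds` two scores differ by a factor of at
most `2 ^ (|w| + 1)`. -/
theorem improvement_mem_EXPAPX : improvement ∈ OptProblem.EXPAPX := by
  refine ⟨improvement_inNPO, fun n => 2 ^ (n + 1), ⟨Polynomial.X + 1, fun n => ⟨?_, ?_⟩⟩,
    .skip, trivial, 1, fun w => Reaches.haltsWithin ⟨_, (Ends.skip _).mono (by simp), [], ?_, ?_⟩ _⟩
  · exact one_le_pow₀ (by norm_num)
  · simp
  · simp [load, bits]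
  · obtain ⟨z, hz⟩ := improvement_exists_isOptimal w
    refine ⟨show [].length ≤ w.length by simp, z, hz, ?_⟩
    rw [← NNReal.coe_eq_zero, ← NNReal.coe_eq_zero, coe_measure_improvement,
      coe_measure_improvement]
    obtain ⟨h1, h2⟩ := score_bounds w (bits z)
    obtain ⟨h3, h4⟩ := score_bounds w (bits [])
    have hs : improvement.size w = w.length := rfl
    rw [hs, abs_of_nonneg (by positivity)]
    have hp : (0 : ℝ) < 2 ^ (w.length + 1) := by positivity
    refine ⟨fun h => by linarith, fun _ => ⟨?_, ?_⟩⟩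
    · rw [div_le_div_iff₀ hp (by linarith)]
      nlinarith
    · rw [div_le_iff₀ (by linarith)]
      nlinarith

/-! ## Evaluating well-formed words -/

theorem evalWord_nil (B : List ℝ) (σ : EvalState) : evalWord B [] σ = σ := rfl

theorem evalWord_cons (B : List ℝ) (v : ℝ) (w : List ℝ) (σ : EvalState) :
    evalWord B (v :: w) σ = evalWord B w (σ.read (pick B (position v) 0) v) := rfl

theorem evalWord_append (B w w' : List ℝ) (σ : EvalState) :
    evalWord B (w ++ w') σ = evalWord B w' (evalWord B w σ) := List.foldl_append

theorem pick_natCast (B : List ℝ) (i : ℕ) (b : ℝ) : pick B i b = B.getD i b := by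
  -- Once the entry is found the counter is negative and never meets 0 again.
  have hneg : ∀ (B : List ℝ) (u b : ℝ), u < 0 → pick B u b = b := by
    intro B
    induction B with
    | nil => intros; rfl
    | cons x B ih =>
      intro u b hu
      rw [pick, if_neg hu.ne, ih _ _ (by linarith)]
  induction B generalizing i b with
  | nil => simp [pick]
  | cons x B ih =>
    cases i with
    | zero => simp [pick, hneg]
    | succ i =>
      have : ((i + 1 : ℕ) : ℝ) ≠ 0 := by positivity
      rw [pick, if_neg this, Nat.cast_succ, add_sub_cancel_right, ih]
      simp

/-- The real number `0` or `1` that stands for a bit. -/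
def bit (b : Bool) : ℝ := if b then 1 else 0

/-- The word `B` represents the assignment `c`. -/
def Represents {n : ℕ} (B : List ℝ) (c : Fin n → Bool) : Prop :=
  ∀ i : Fin n, pick B (i : ℕ) 0 = bit (c i)

theorem represents_bits {n : ℕ} (y : List Bool) :
    Represents (bits y) fun i : Fin n => y.getD i false := by
  intro i
  rw [pick_natCast, bits, bit]
  have := List.getD_map (l := y) (d := false) (n := (i : ℕ))
    (fun b : Bool => if b then (1 : ℝ) else 0)
  simpa using this

theorem represents_ofFn {n : ℕ} (c : Fin n → Bool) : Represents (bits (List.ofFn c)) c := by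
  have := represents_bits (n := n) (List.ofFn c)
  simpa using this

section

variable {n : ℕ} {B : List ℝ} {c : Fin n → Bool}

/-! ### Applications of constraints -/

/-- The rank of a binary vector in the lexicographic order. -/
def lexRank : (k : ℕ) → (Fin k → Bool) → ℕ
  | 0, _ => 0
  | k + 1, v => (v 0).toNat * 2 ^ k + lexRank k (Fin.tail v)

theorem lexRank_lt (k : ℕ) (v : Fin k → Bool) : lexRank k v < 2 ^ k := by
  induction k with
  | zero => simp [lexRank]
  | succ k ih =>
    have := ih (Fin.tail v)
    rw [lexRank, pow_succ]
    cases v 0 <;> simp <;> lia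

/-- Reading the argument bits from the first to the last is Horner's scheme for the lexicographic
rank, while `left` doubles up to the length of the table. -/
theorem evalWord_args (hB : Represents B c) (k : ℕ) (args : Fin k → Fin n) (σ : EvalState)
    (hp : σ.pending = k) (hl : 0 < σ.left) :
    evalWord B (List.ofFn fun i => ((args i : ℕ) : ℝ)) σ =
      { σ with
        pending := 0
        index := σ.index * 2 ^ k + lexRank k fun i => c (args i)
        left := σ.left * 2 ^ k } := by
  induction k generalizing σ with
  | zero =>
    ext <;> simp [evalWord, lexRank, hp]
  | succ k ih =>
    have h1 : (1 : ℝ) ≤ σ.pending := by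
      rw [hp]
      push_cast
      linarith [Nat.cast_nonneg (α := ℝ) k]
    have h2 : (0 : ℝ) ≤ ((args 0 : ℕ) : ℝ) := Nat.cast_nonneg _
    have h3 : σ.read (pick B (position ((args 0 : ℕ) : ℝ)) 0) ((args 0 : ℕ) : ℝ) =
        { σ with
          index := σ.index + σ.index + bit (c (args 0))
          left := σ.left + σ.left
          pending := σ.pending - 1 } := by
      rw [EvalState.read, if_pos h2, if_neg (not_le.2 hl), if_pos h1, position, if_pos h2,
        hB (args 0)]
    rw [List.ofFn_succ, evalWord_cons, h3, ih (fun i => args i.succ) _ (by simp [hp])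
      (by simpa using hl)]
    have h4 : (bit (c (args 0)) : ℝ) = ((c (args 0)).toNat : ℕ) := by
      cases c (args 0) <;> simp [bit]
    have h5 : (Fin.tail fun i => c (args i)) = fun i => c (args i.succ) := rfl
    ext <;> simp [lexRank, pow_succ, h4, h5] <;> ring

/-- An index inside the table selects one entry; an index outside it selects none. The induction
splits the table into halves and needs both cases together, since exactly one half contains the
selected entry. -/
theorem evalWord_table (k : ℕ) (f : (Fin k → Bool) → ℝ≥0) (σ : EvalState)
    (hp : σ.pending < 1) (hl : 2 ^ k ≤ σ.left) :
    (∀ v, σ.index = lexRank k v → evalWord B (table k f) σ =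
      { σ with value := σ.value * f v, index := σ.index - 2 ^ k, left := σ.left - 2 ^ k }) ∧
    (σ.index < 0 ∨ 2 ^ k ≤ σ.index → evalWord B (table k f) σ =
      { σ with index := σ.index - 2 ^ k, left := σ.left - 2 ^ k }) := by
  induction k generalizing σ with
  | zero =>
    have h0 : (0 : ℝ) ≤ f Fin.elim0 := NNReal.coe_nonneg _
    have h1 : ¬ σ.left ≤ 0 := by simp at hl; linarith
    refine ⟨fun v hv => ?_, fun h => ?_⟩
    · have hv' : v = Fin.elim0 := Subsingleton.elim _ _
      subst hv'
      have hv0 : σ.index = 0 := by simpa [lexRank] using hv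
      simp [table, evalWord, EvalState.read, h1, not_le.2 hp, hv0]
    · have hv0 : σ.index ≠ 0 := by
        rcases h with h | h
        · exact h.ne
        · have : (0 : ℝ) < σ.index := lt_of_lt_of_le (by norm_num) h
          exact this.ne'
      simp [table, evalWord, EvalState.read, h1, not_le.2 hp, hv0]
  | succ k ih =>
    have hpos : (0 : ℝ) < 2 ^ k := by positivity
    rw [pow_succ] at hl ⊢
    rw [table]
    simp only [evalWord_append]
    set f₀ : (Fin k → Bool) → ℝ≥0 := fun v => f (Fin.cons false v)
    set f₁ : (Fin k → Bool) → ℝ≥0 := fun v => f (Fin.cons true v)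
    have key : ∀ z : ℝ, σ.left - 2 ^ k - 2 ^ k = σ.left - 2 ^ k * 2 ∧
        z - 2 ^ k - 2 ^ k = z - 2 ^ k * 2 := fun z => ⟨by ring, by ring⟩
    obtain ⟨a1, a2⟩ := ih f₀ σ hp (by linarith)
    refine ⟨fun v hv => ?_, fun h => ?_⟩
    · have hlt : (lexRank k (Fin.tail v) : ℝ) < 2 ^ k := by
        exact_mod_cast lexRank_lt k (Fin.tail v)
      have hc : f v = f (Fin.cons (v 0) (Fin.tail v)) := by rw [Fin.cons_self_tail]
      cases h0 : v 0 with
      | false =>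
        have hi : σ.index = lexRank k (Fin.tail v) := by simpa [lexRank, h0] using hv
        rw [a1 _ hi]
        -- The entry was selected in the first half, so the index is negative throughout the second.
        obtain ⟨-, b2⟩ := ih f₁ { σ with
          value := σ.value * f₀ (Fin.tail v), index := σ.index - 2 ^ k, left := σ.left - 2 ^ k }
          hp (by simp only; linarith)
        rw [b2 (Or.inl (by simp only; linarith)), hc, h0]
        simp only [key, f₀]
      | true =>
        have hi : σ.index - 2 ^ k = lexRank k (Fin.tail v) := by
          rw [hv]
          simp [lexRank, h0]
        rw [a2 (Or.inr (by linarith [Nat.cast_nonneg (α := ℝ) (lexRank k (Fin.tail v))]))]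
        obtain ⟨b1, -⟩ := ih f₁ { σ with index := σ.index - 2 ^ k, left := σ.left - 2 ^ k }
          hp (by simp only; linarith)
        rw [b1 _ hi, hc, h0]
        simp only [key, f₁]
    · rw [a2 (by rcases h with h | h; exacts [Or.inl h, Or.inr (by linarith)])]
      obtain ⟨-, b2⟩ := ih f₁ { σ with index := σ.index - 2 ^ k, left := σ.left - 2 ^ k }
        hp (by simp only; linarith)
      rw [b2 (by
        simp only
        rcases h with h | h
        exacts [Or.inl (by linarith), Or.inr (by linarith)])]
      simp only [key]

theorem evalWord_app (hB : Represents B c) (a : App n) (σ : EvalState) (hl : σ.left = 0) :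
    (evalWord B a.encode σ).left = 0 ∧ (evalWord B a.encode σ).level = σ.level ∧
    (evalWord B a.encode σ).value = σ.value * a.con.val fun i => c (a.args i) := by
  have h0 : (0 : ℝ) ≤ a.con.arity := Nat.cast_nonneg _
  rw [App.encode, evalWord_cons, evalWord_append, EvalState.read, if_pos h0, if_pos hl.le,
    evalWord_args hB _ _ _ rfl (by simp)]
  obtain ⟨h1, -⟩ := evalWord_table (B := B) a.con.arity a.con.val
    { σ with
      pending := 0
      index := (0 : ℝ) * 2 ^ a.con.arity + lexRank a.con.arity fun i => c (a.args i)
      left := (1 : ℝ) * 2 ^ a.con.arity } (by simp) (by simp)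
  rw [h1 (fun i => c (a.args i)) (by simp)]
  simp

/-- The product of the values of a list of applications. -/
def valueOf (l : List (App n)) (c : Fin n → Bool) : ℝ :=
  (l.map fun a => ((a.con.val fun i => c (a.args i) : ℝ≥0) : ℝ)).prod

theorem evalWord_apps (hB : Represents B c) (l : List (App n)) (σ : EvalState)
    (hl : σ.left = 0) :
    (evalWord B (l.flatMap App.encode) σ).level = σ.level ∧
    (evalWord B (l.flatMap App.encode) σ).value = σ.value * valueOf l c := by
  induction l generalizing σ with
  | nil => simp [evalWord, valueOf]
  | cons a l ih =>
    obtain ⟨h1, h2, h3⟩ := evalWord_app hB a σ hl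
    obtain ⟨h4, h5⟩ := ih _ h1
    rw [List.flatMap_cons, evalWord_append, h4, h5, h2, h3]
    simp [valueOf, mul_assoc]

/-! ### Parity checks -/

/-- The word of the parity check that contains the variables selected by `f`. -/
def rowWord {n : ℕ} (f : Fin n → Bool) : List ℝ :=
  (List.ofFn fun i : Fin n => if f i then [-((i : ℕ) + 1 : ℝ)] else []).flatten

/-- The word of a list of parity checks. -/
def hashWord {R n : ℕ} (g : Fin R → Fin n → Bool) : List ℝ :=
  (List.ofFn fun r => rowWord (g r) ++ [-(1 / 2)]).flatten

/-- The sign of a parity check at an assignment. -/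
def parity {n : ℕ} (f c : Fin n → Bool) : ℝ := ∏ i, if f i && c i then -1 else 1

theorem evalWord_row (hB : Represents B c) (f : Fin n → Bool) (σ : EvalState) :
    evalWord B (rowWord f) σ = { σ with sign := σ.sign * parity f c } := by
  rw [rowWord, parity, Fin.prod_univ_def, List.ofFn_eq_map]
  generalize List.finRange n = l
  induction l generalizing σ with
  | nil => simp [evalWord]
  | cons i l ih =>
    rw [List.map_cons, List.flatten_cons, evalWord_append, ih]
    cases hf : f i with
    | false => simp [evalWord, hf]
    | true =>
      have h1 : ¬ (0 : ℝ) ≤ -((i : ℕ) + 1 : ℝ) := by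
        have := Nat.cast_nonneg (α := ℝ) (i : ℕ)
        linarith
      have h2 : position (-((i : ℕ) + 1 : ℝ)) = (i : ℕ) := by
        rw [position, if_neg h1]
        ring
      rw [if_pos rfl, evalWord_cons, evalWord_nil, EvalState.read, if_neg h1, h2,
        if_pos (Nat.cast_nonneg _), hB i]
      cases hc : c i <;> simp [bit, hf, hc]

-- The flag `alive` freezes the level after the first failure. Its final value is irrelevant, since
-- the applications that follow do not read it.
open Classical in
theorem evalWord_checks (hB : Represents B c) (l : List (Fin n → Bool)) (σ : EvalState)
    (hs : σ.sign = 1) :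
    ∃ a, evalWord B (l.map fun f => rowWord f ++ [-(1 / 2)]).flatten σ =
      { σ with
        alive := a
        level := if 1 ≤ σ.alive then
            σ.level * 2 ^ (l.takeWhile fun f => decide (1 ≤ parity f c)).length
          else σ.level } := by
  induction l generalizing σ with
  | nil => exact ⟨σ.alive, by simp [evalWord]⟩
  | cons f l ih =>
    have h1 : ¬ (0 : ℝ) ≤ -(1 / 2) := by norm_num
    have h2 : ¬ (0 : ℝ) ≤ position (-(1 / 2)) := by
      rw [position, if_neg h1]
      norm_num
    rw [List.map_cons, List.flatten_cons, evalWord_append, evalWord_append, evalWord_row hB,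
      evalWord_cons, evalWord_nil, EvalState.read, if_neg h1, if_neg h2, hs, one_mul]
    by_cases ha : 1 ≤ σ.alive
    · by_cases hp : 1 ≤ parity f c
      · obtain ⟨a, h⟩ := ih { σ with level := σ.level + σ.level, sign := 1 } rfl
        refine ⟨a, ?_⟩
        rw [if_pos ⟨ha, hp⟩]
        simp only at h ⊢
        rw [h]
        ext <;> simp [ha, hp, pow_succ]
        ring
      · obtain ⟨a, h⟩ := ih { σ with alive := 0, sign := 1 } rfl
        refine ⟨a, ?_⟩
        rw [if_neg (fun h => hp h.2)]
        simp only at h ⊢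
        rw [h]
        have : ¬ (1 : ℝ) ≤ 0 := by norm_num
        ext <;> simp [ha, hp, this]
    · obtain ⟨a, h⟩ := ih { σ with alive := 0, sign := 1 } rfl
      refine ⟨a, ?_⟩
      rw [if_neg (fun h => ha h.1)]
      simp only at h ⊢
      rw [h]
      have : ¬ (1 : ℝ) ≤ 0 := by norm_num
      ext <;> simp [ha, this]

open Classical in
/-- The number of parity checks that an assignment passes before its first failure. -/
def passes {R : ℕ} (g : Fin R → Fin n → Bool) (c : Fin n → Bool) : ℕ :=
  ((List.ofFn g).takeWhile fun f => decide (1 ≤ parity f c)).length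

theorem evalWord_hash_apps (hB : Represents B c) {R : ℕ} (g : Fin R → Fin n → Bool)
    (l : List (App n)) :
    (evalWord B (hashWord g ++ l.flatMap App.encode) .init).level = 2 ^ passes g c ∧
    (evalWord B (hashWord g ++ l.flatMap App.encode) .init).value = valueOf l c := by
  obtain ⟨a, h⟩ := evalWord_checks hB (List.ofFn g) .init rfl
  have e : hashWord g = ((List.ofFn g).map fun f => rowWord f ++ [-(1 / 2)]).flatten := by
    rw [hashWord, List.map_ofFn]
    rfl
  rw [evalWord_append, e, h]
  obtain ⟨h1, h2⟩ := evalWord_apps hB l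
    { EvalState.init with
      alive := a
      level := if 1 ≤ EvalState.init.alive then EvalState.init.level *
          2 ^ ((List.ofFn g).takeWhile fun f => decide (1 ≤ parity f c)).length
        else EvalState.init.level } rfl
  rw [h1, h2]
  simp [EvalState.init, passes]

end

/-- The instance of the target problem with threshold `T`. -/
def query {R n : ℕ} (T : ℝ) (g : Fin R → Fin n → Bool) (l : List (App n)) : List ℝ :=
  T :: (hashWord g ++ l.flatMap App.encode)

open Classical in
theorem score_query {R n : ℕ} {B : List ℝ} {c : Fin n → Bool} (hB : Represents B c) (T : ℝ)
    (g : Fin R → Fin n → Bool) (l : List (App n)) :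
    score (query T g l) B = if valueOf l c ≤ T then 1 else 2 ^ (passes g c + 1) := by
  obtain ⟨h1, h2⟩ := evalWord_hash_apps hB g l
  rw [score, query, List.tail_cons, List.headD_cons, h1, h2, pow_succ, mul_two]

/-- Passing a prefix is a conjunction over rows, the form in which the independence of the rows can
be used. -/
theorem le_passes_iff {R n : ℕ} (g : Fin R → Fin n → Bool) (c : Fin n → Bool) {j : ℕ}
    (hj : j ≤ R) : j ≤ passes g c ↔ ∀ r : Fin R, (r : ℕ) < j → 1 ≤ parity (g r) c := by
  classical
  unfold passes
  induction R generalizing j with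
  | zero => simp; lia
  | succ R ih =>
    rw [List.ofFn_succ, List.takeWhile_cons]
    cases j with
    | zero => simp
    | succ j =>
      rw [Fin.forall_fin_succ]
      by_cases h : 1 ≤ parity (g 0) c
      · simp [h, ih (fun r => g r.succ) (Nat.le_of_succ_le_succ hj)]
      · simp [h]

/-! ## Averages over coin flips -/

/-- The average of a function on a finite type. -/
def mean {α : Type*} [Fintype α] (F : α → ℝ≥0∞) : ℝ≥0∞ := (Fintype.card α : ℝ≥0∞)⁻¹ * ∑ a, F a

theorem mean_mono {α : Type*} [Fintype α] {F G : α → ℝ≥0∞} (h : ∀ a, F a ≤ G a) :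
    mean F ≤ mean G := mul_le_mul_right (Finset.sum_le_sum fun a _ => h a) _

theorem mean_const {α : Type*} [Fintype α] [Nonempty α] (x : ℝ≥0∞) :
    mean (fun _ : α => x) = x := by
  rw [mean, Finset.sum_const, nsmul_eq_mul, ← mul_assoc, Finset.card_univ,
    ENNReal.inv_mul_cancel (by simp) (by simp), one_mul]

theorem mean_unique {α : Type*} [Fintype α] [Unique α] (F : α → ℝ≥0∞) : mean F = F default := by
  simp [mean]

/-- The last coordinate is averaged outermost because the program draws the variables and the checks
from last to first; pushing onto a stack reverses the order. -/
theorem mean_snoc {β : Type*} [Fintype β] [Nonempty β] {i : ℕ}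
    (F : (Fin (i + 1) → β) → ℝ≥0∞) :
    mean F = mean fun b => mean fun g : Fin i → β => F (Fin.snoc g b) := by
  have h : ∑ f, F f = ∑ b, ∑ g : Fin i → β, F (Fin.snoc g b) := by
    rw [← Fintype.sum_prod_type']
    exact (Fintype.sum_equiv (Fin.snocEquiv fun _ => β) _ _ fun _ => rfl).symm
  simp only [mean, h, Fintype.card_fun, Fintype.card_fin, ← Finset.mul_sum, ← mul_assoc]
  congr 1
  rw [← ENNReal.mul_inv (by simp) (by simp), pow_succ']
  simp

/-! ## The reduction -/

section

variable {O : Oracle} {ψ : Store → ℝ≥0∞}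

theorem expect_flip (r : ℕ) (K : List Prog) (s : Store) (m : ℕ) :
    expect O ψ (m + 1) ⟨.flip r :: K, s⟩ = mean fun b : Bool =>
      expect O ψ m ⟨K, { s with reg := Function.update s.reg r (bit b) }⟩ := by
  rw [expect, if_neg (by simp [BadQuery])]
  simp only [step]
  rw [tsum_map_mul, tsum_fintype, mean, Finset.mul_sum]
  simp [bit, PMF.uniformOfFintype_apply]

theorem expect_query {k d a : ℕ} {s : Store} (hd : s.reg d = 1 / 2) (K : List Prog) (m : ℕ) :
    expect O ψ (m + 1) ⟨.query k d a :: K, s⟩ = ∑' z, O (s.stk k) (1 / 2) z *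
      expect O ψ m ⟨K, { s with stk := Function.update s.stk a z }⟩ := by
  rw [expect, if_neg (by simpa [BadQuery] using hd)]
  simp only [step]
  rw [tsum_map_mul, hd]

/-! ### Random parity checks

Register `17` holds the number of variables, register `18` counts variables, register `19` counts
parity checks, and register `22` holds the end marker of a parity check. -/

def flipRest : Prog :=
  block [.ite (.le 15 13) (.seq (.instr (.sub 12 14 18)) (.instr (.push 0 12))) .skip,
    .instr (.sub 18 18 15)]

/-- Push the word of a random parity check onto stack `0`. -/
def flipLoop : Prog := .loop (.le 15 18) (.seq (.flip 13) flipRest)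

theorem rowWord_snoc {i : ℕ} (f : Fin i → Bool) (b : Bool) :
    rowWord (Fin.snoc f b : Fin (i + 1) → Bool) =
      rowWord f ++ if b then [-((i : ℝ) + 1)] else [] := by
  rw [rowWord, List.ofFn_succ', List.concat_eq_append, List.flatten_append]
  simp [rowWord]

/-- A random program has no single final memory, so the rule bounds the continuation by `F f` for
every outcome `f` and concludes with the average over outcomes. An iteration costs 12 steps: 3 for
the loop, the sequence and the flip, and 9 for `flipRest`. -/
theorem flipLoop_expect (K : List Prog) (m i : ℕ) (s : Store) (h14 : s.reg 14 = 0)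
    (h15 : s.reg 15 = 1) (h18 : s.reg 18 = i) (F : (Fin i → Bool) → ℝ≥0∞)
    (hK : ∀ f s', (∀ r, r ≠ 12 → r ≠ 13 → r ≠ 18 → s'.reg r = s.reg r) →
      (∀ k, k ≠ 0 → s'.stk k = s.stk k) → s'.stk 0 = rowWord f ++ s.stk 0 →
      F f ≤ expect O ψ m ⟨K, s'⟩) :
    mean F ≤ expect O ψ (m + (12 * i + 1)) ⟨flipLoop :: K, s⟩ := by
  induction i generalizing s with
  | zero =>
    rw [flipLoop, mul_zero, zero_add, expect_loop_false (by simp [Test.Holds, h15, h18]),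
      mean_unique]
    exact hK _ s (fun _ _ _ _ => rfl) (fun _ _ => rfl) (by simp [rowWord])
  | succ i ih =>
    have hb : (Test.le 15 18).Holds s := by
      simp only [Test.Holds, h15, h18]
      push_cast
      linarith [Nat.cast_nonneg (α := ℝ) i]
    have ht : m + (12 * (i + 1) + 1) = m + (12 * i + 1) + 9 + 1 + 1 + 1 := by ring
    rw [flipLoop, ht, expect_loop_true hb, expect_seq, expect_flip, mean_snoc]
    refine mean_mono fun b => ?_
    set s₁ : Store := { s with reg := Function.update s.reg 13 (bit b) } with hs₁
    have hS : flipRest.Straight := by simp [flipRest, block, Prog.Straight]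
    refine le_trans ?_ ((hS.ends s₁).mono (show flipRest.nodes ≤ 9 from le_of_eq rfl) O ψ _ _)
    have h10 : ¬ (1 : ℝ) ≤ 0 := by norm_num
    have hreg : ∀ r, r ≠ 12 → r ≠ 13 → r ≠ 18 → (flipRest.effect s₁).reg r = s.reg r := by
      intro r h1 h2 h3
      cases b <;>
      simp [hs₁, flipRest, block, Prog.effect, Instr.exec, Test.Holds, bit, h10, h15, h1, h2,
        h3]
    have hstk : ∀ k, k ≠ 0 → (flipRest.effect s₁).stk k = s.stk k := by
      intro k hk
      cases b <;>
      simp [hs₁, flipRest, block, Prog.effect, Instr.exec, Test.Holds, bit, h10, h15, hk]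
    have h0 : (flipRest.effect s₁).stk 0 =
        (if b then [-((i : ℝ) + 1)] else []) ++ s.stk 0 := by
      cases b <;>
      simp [hs₁, flipRest, block, Prog.effect, Instr.exec, Test.Holds, bit, h10, h14, h15, h18]
    have h18' : (flipRest.effect s₁).reg 18 = i := by
      cases b <;>
      simp [hs₁, flipRest, block, Prog.effect, Instr.exec, Test.Holds, bit, h10, h15, h18]
    refine ih (flipRest.effect s₁) (by rw [hreg 14 (by simp) (by simp) (by simp), h14])
      (by rw [hreg 15 (by simp) (by simp) (by simp), h15]) h18' _ ?_
    intro f s' g1 g2 g3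
    refine hK _ s' (fun r a b c => by rw [g1 r a b c, hreg r a b c])
      (fun k hk => by rw [g2 k hk, hstk k hk]) ?_
    rw [g3, h0, rowWord_snoc, List.append_assoc]

def rowBody : Prog :=
  .seq (.instr (.push 0 22)) (.seq (.instr (.copy 18 17)) (.seq flipLoop (.instr (.sub 19 19 15))))

/-- Push the words of random parity checks onto stack `0`. -/
def hashLoop : Prog := .loop (.le 15 19) rowBody

theorem hashWord_snoc {R n : ℕ} (g : Fin R → Fin n → Bool) (f : Fin n → Bool) :
    hashWord (Fin.snoc g f : Fin (R + 1) → Fin n → Bool) =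
      hashWord g ++ (rowWord f ++ [-(1 / 2)]) := by
  rw [hashWord, List.ofFn_succ', List.concat_eq_append, List.flatten_append]
  simp [hashWord]

theorem hashLoop_expect (K : List Prog) (m n R : ℕ) (s : Store) (h14 : s.reg 14 = 0)
    (h15 : s.reg 15 = 1) (h17 : s.reg 17 = n) (h19 : s.reg 19 = R) (h22 : s.reg 22 = -(1 / 2))
    (F : (Fin R → Fin n → Bool) → ℝ≥0∞)
    (hK : ∀ g s', (∀ r, r ≠ 12 → r ≠ 13 → r ≠ 18 → r ≠ 19 → s'.reg r = s.reg r) →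
      (∀ k, k ≠ 0 → s'.stk k = s.stk k) → s'.stk 0 = hashWord g ++ s.stk 0 →
      F g ≤ expect O ψ m ⟨K, s'⟩) :
    mean F ≤ expect O ψ (m + ((12 * n + 8) * R + 1)) ⟨hashLoop :: K, s⟩ := by
  induction R generalizing s with
  | zero =>
    rw [hashLoop, mul_zero, zero_add, expect_loop_false (by simp [Test.Holds, h15, h19]),
      mean_unique]
    exact hK _ s (fun _ _ _ _ _ => rfl) (fun _ _ => rfl) (by simp [hashWord])
  | succ R ih =>
    have hb : (Test.le 15 19).Holds s := by
      simp only [Test.Holds, h15, h19]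
      push_cast
      linarith [Nat.cast_nonneg (α := ℝ) R]
    -- The budget is split so that one unit is consumed by each sequence, instruction and loop test,
    -- and `12 * n + 1` by the inner loop.
    have ht : m + ((12 * n + 8) * (R + 1) + 1) =
        m + ((12 * n + 8) * R + 1) + 1 + (12 * n + 1) + 1 + 1 + 1 + 1 + 1 + 1 := by ring
    rw [hashLoop, ht, expect_loop_true hb, rowBody, expect_seq]
    refine le_trans ?_ (Ends.instr (.push 0 22) s O ψ _ _)
    rw [expect_seq]
    refine le_trans ?_ (Ends.instr (.copy 18 17) _ O ψ _ _)
    rw [expect_seq, mean_snoc]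
    refine flipLoop_expect _ _ n _ ?_ ?_ ?_ _ ?_
    · simpa [Instr.exec] using h14
    · simpa [Instr.exec] using h15
    · simpa [Instr.exec] using h17
    intro f s₁ a1 a2 a3
    have a1' : ∀ r, r ≠ 12 → r ≠ 13 → r ≠ 18 → s₁.reg r = s.reg r := fun r p q u => by
      rw [a1 r p q u]
      simp [Instr.exec, u]
    have a2' : ∀ k, k ≠ 0 → s₁.stk k = s.stk k := fun k hk => by
      rw [a2 k hk]
      simp [Instr.exec, hk]
    have a3' : s₁.stk 0 = rowWord f ++ -(1 / 2) :: s.stk 0 := by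
      rw [a3]
      simp [Instr.exec, h22]
    refine le_trans ?_ (Ends.instr (.sub 19 19 15) s₁ O ψ _ _)
    refine ih _ ?_ ?_ ?_ ?_ ?_ _ ?_
    · simp [Instr.exec, a1', h14]
    · simp [Instr.exec, a1', h15]
    · simp [Instr.exec, a1', h17]
    · simp [Instr.exec, a1', h19, h15]
    · simp [Instr.exec, a1', h22]
    · intro g s' b1 b2 b3
      refine hK _ s' (fun r p q u v => ?_) (fun k hk => ?_) ?_
      · rw [b1 r p q u v]
        simp [Instr.exec, a1' r p q u, v]
      · rw [b2 k hk]
        simp [Instr.exec, a2' k hk]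
      · rw [b3, hashWord_snoc]
        simp [Instr.exec, a3']

end

/-! ### Using an answer of the oracle -/

open Classical in
/-- The assignment described by an arbitrary word. -/
def toAssignment (n : ℕ) (z : List ℝ) : Fin n → Bool := fun i => decide (1 ≤ z.getD i 0)

def roundingBody : Prog :=
  block [.instr (.pop 13 6), .ite (.le 15 13) (.instr (.push 3 15)) (.instr (.push 3 14)),
    .instr (.sub 18 18 15)]

def roundingLoop : Prog := .loop (.le 15 18) roundingBody

/-- The oracle may return any real word. Reading exactly `i` entries, with 0 for missing ones,
yields an assignment in bounded time whatever the length of the answer. -/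
theorem roundingLoop_reaches (i : ℕ) (s : Store) (h14 : s.reg 14 = 0) (h15 : s.reg 15 = 1)
    (h18 : s.reg 18 = i) :
    Reaches roundingLoop s (10 * i + 1) fun s' =>
      (∀ r, r ≠ 13 → r ≠ 18 → s'.reg r = s.reg r) ∧
      s'.stk 3 = (bits (List.ofFn (toAssignment i (s.stk 6)))).reverse ++ s.stk 3 ∧
      ∀ k, k ≠ 3 → k ≠ 6 → s'.stk k = s.stk k := by
  induction i generalizing s with
  | zero =>
    refine ⟨s, (Ends.loop_false ?_).mono (by simp), ?_⟩
    · simp [Test.Holds, h15, h18]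
    · simp [bits]
  | succ i ih =>
    have hb : (Test.le 15 18).Holds s := by
      simp only [Test.Holds, h15, h18]
      push_cast
      linarith [Nat.cast_nonneg (α := ℝ) i]
    have hS : roundingBody.Straight := by simp [roundingBody, block, Prog.Straight]
    have hreg : ∀ r, r ≠ 13 → r ≠ 18 → (roundingBody.effect s).reg r = s.reg r := by
      intro r h1 h2
      by_cases h : 1 ≤ (s.stk 6).head?.getD 0 <;>
      simp [roundingBody, block, Prog.effect, Instr.exec, Test.Holds, h15, h1, h2, h]
    have hstk : ∀ k, k ≠ 3 → k ≠ 6 → (roundingBody.effect s).stk k = s.stk k := by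
      intro k h1 h2
      by_cases h : 1 ≤ (s.stk 6).head?.getD 0 <;>
      simp [roundingBody, block, Prog.effect, Instr.exec, Test.Holds, h15, h1, h2, h]
    have h6 : (roundingBody.effect s).stk 6 = (s.stk 6).tail := by
      by_cases h : 1 ≤ (s.stk 6).head?.getD 0 <;>
      simp [roundingBody, block, Prog.effect, Instr.exec, Test.Holds, h15, h]
    have h3 : (roundingBody.effect s).stk 3 =
        bit (toAssignment (i + 1) (s.stk 6) 0) :: s.stk 3 := by
      have e : (s.stk 6)[0]?.getD 0 = (s.stk 6).head?.getD 0 := by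
        rw [List.head?_eq_getElem?]
      by_cases h : 1 ≤ (s.stk 6).head?.getD 0 <;>
      simp [roundingBody, block, Prog.effect, Instr.exec, Test.Holds, h14, h15, h, toAssignment,
        bit, e]
    have h18' : (roundingBody.effect s).reg 18 = i := by
      by_cases h : 1 ≤ (s.stk 6).head?.getD 0 <;>
      simp [roundingBody, block, Prog.effect, Instr.exec, Test.Holds, h15, h, h18]
    obtain ⟨s', e, g1, g2, g3⟩ := ih (roundingBody.effect s)
      (by rw [hreg 14 (by simp) (by simp), h14])
      (by rw [hreg 15 (by simp) (by simp), h15]) h18'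
    refine ⟨s', ((hS.ends s).loop_true hb e).mono ?_, ?_, ?_, ?_⟩
    · have : roundingBody.nodes = 9 := rfl
      lia
    · intro r p q
      rw [g1 r p q, hreg r p q]
    · have e : toAssignment i (s.stk 6).tail =
          fun j => toAssignment (i + 1) (s.stk 6) j.succ := by
        funext j
        simp [toAssignment]
      rw [g2, h3, h6, List.ofFn_succ, e]
      simp [bits, bit]
    · intro k p q
      rw [g3 k p q, hstk k p q]

def restoreBody : Prog :=
  .seq (.instr (.pop 13 4)) (.ite (.le 14 13) (.instr (.push 0 13)) .skip)

/-- Move the nonnegative entries of stack `4` back to stack `0`. -/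
def restoreLoop : Prog := .loop (.neg (.empty 4)) restoreBody

open Classical in
theorem restoreLoop_reaches (s : Store) (h14 : s.reg 14 = 0) :
    Reaches restoreLoop s (6 * (s.stk 4).length + 1) fun s' =>
      (∀ r, r ≠ 13 → s'.reg r = s.reg r) ∧
      s'.stk 0 = ((s.stk 4).filter fun x => decide (0 ≤ x)).reverse ++ s.stk 0 ∧
      s'.stk 4 = [] ∧ ∀ k, k ≠ 0 → k ≠ 4 → s'.stk k = s.stk k := by
  generalize hl : s.stk 4 = l
  induction l generalizing s with
  | nil =>
    refine ⟨s, (Ends.loop_false (by simp [Test.Holds, hl])).mono (by simp), ?_⟩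
    simp [hl]
  | cons x l ih =>
    have hS : restoreBody.Straight := by simp [restoreBody, Prog.Straight]
    have hreg : ∀ r, r ≠ 13 → (restoreBody.effect s).reg r = s.reg r := by
      intro r h1
      by_cases h : 0 ≤ x <;>
      simp [restoreBody, Prog.effect, Instr.exec, Test.Holds, h14, hl, h1, h]
    have hstk : ∀ k, k ≠ 0 → k ≠ 4 → (restoreBody.effect s).stk k = s.stk k := by
      intro k h1 h2
      by_cases h : 0 ≤ x <;>
      simp [restoreBody, Prog.effect, Instr.exec, Test.Holds, h14, hl, h1, h2, h]
    have h4 : (restoreBody.effect s).stk 4 = l := by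
      by_cases h : 0 ≤ x <;>
      simp [restoreBody, Prog.effect, Instr.exec, Test.Holds, h14, hl, h]
    have h0 : (restoreBody.effect s).stk 0 = (if 0 ≤ x then [x] else []) ++ s.stk 0 := by
      by_cases h : 0 ≤ x <;>
      simp [restoreBody, Prog.effect, Instr.exec, Test.Holds, h14, hl, h]
    obtain ⟨s', e, g1, g2, g3, g4⟩ := ih (restoreBody.effect s) (by rw [hreg 14 (by simp), h14]) h4
    refine ⟨s', ((hS.ends s).loop_true (by simp [Test.Holds, hl]) e).mono ?_, ?_, ?_, g3, ?_⟩
    · have : restoreBody.nodes = 5 := rfl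
      simp only [List.length_cons]
      lia
    · intro r hr
      rw [g1 r hr, hreg r hr]
    · rw [g2, h0]
      by_cases h : 0 ≤ x <;> simp [h]
    · intro k p q
      rw [g4 k p q, hstk k p q]

theorem table_nonneg (k : ℕ) (f : (Fin k → Bool) → ℝ≥0) : ∀ x ∈ table k f, 0 ≤ x := by
  induction k with
  | zero => simp [table]
  | succ k ih =>
    intro x hx
    rcases List.mem_append.1 hx with h | h
    · exact ih _ x h
    · exact ih _ x h

-- Parity checks consist of negative entries and applications of nonnegative ones, so the sign alone
-- recovers the instance after a query.
open Classical in
theorem filter_word {R n : ℕ} (g : Fin R → Fin n → Bool) (l : List (App n)) :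
    ((hashWord g ++ l.flatMap App.encode).filter fun x => decide (0 ≤ x)) =
      l.flatMap App.encode := by
  have h1 : (hashWord g).filter (fun x => decide (0 ≤ x)) = [] := by
    rw [List.filter_eq_nil_iff]
    intro x hx
    simp only [hashWord, rowWord, List.mem_flatten, List.mem_ofFn] at hx
    obtain ⟨u, ⟨r, rfl⟩, hx⟩ := hx
    rcases List.mem_append.1 hx with hx | hx
    · obtain ⟨v, hv, hx⟩ := List.mem_flatten.1 hx
      obtain ⟨i, rfl⟩ := List.mem_ofFn.1 hv
      split_ifs at hx
      · rw [List.mem_singleton.1 hx]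
        have := Nat.cast_nonneg (α := ℝ) (i : ℕ)
        simp only [decide_eq_true_eq, not_le]
        linarith
      · simp at hx
    · rw [List.mem_singleton.1 hx]
      norm_num
  have h2 : (l.flatMap App.encode).filter (fun x => decide (0 ≤ x)) = l.flatMap App.encode := by
    rw [List.filter_eq_self]
    intro x hx
    obtain ⟨a, -, hx⟩ := List.mem_flatMap.1 hx
    rw [App.encode, List.mem_cons, List.mem_append, List.mem_ofFn] at hx
    rw [decide_eq_true_eq]
    rcases hx with rfl | ⟨i, rfl⟩ | hx
    · exact Nat.cast_nonneg _
    · exact Nat.cast_nonneg _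
    · exact table_nonneg _ _ x hx
  rw [List.filter_append, h1, h2, List.nil_append]

theorem rowWord_length {n : ℕ} (f : Fin n → Bool) : (rowWord f).length ≤ n := by
  induction n with
  | zero => simp [rowWord]
  | succ n ih =>
    rw [← Fin.snoc_init_self f, rowWord_snoc, List.length_append]
    have := ih (Fin.init f)
    split_ifs <;> simp <;> lia

theorem hashWord_length {R n : ℕ} (g : Fin R → Fin n → Bool) :
    (hashWord g).length ≤ R * (n + 1) := by
  induction R with
  | zero => simp [hashWord]
  | succ R ih =>
    rw [← Fin.snoc_init_self g, hashWord_snoc, List.length_append, List.length_append]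
    have := ih (Fin.init g)
    have := rowWord_length (g (Fin.last R))
    simp
    lia

/-- Evaluate the word on stack `0` against stack `2` and remove its negative entries. -/
def testProg : Prog := .seq evalProg restoreLoop

/-- Parity checks do not influence the product, so the query word itself serves to evaluate the
answer and is cleaned up afterwards. -/
theorem testProg_reaches {R n : ℕ} (g : Fin R → Fin n → Bool) (l : List (App n))
    (c : Fin n → Bool) (s : Store) (h14 : s.reg 14 = 0) (h15 : s.reg 15 = 1)
    (h0 : s.stk 0 = hashWord g ++ l.flatMap App.encode) (h2 : s.stk 2 = bits (List.ofFn c))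
    (h3 : s.stk 3 = []) (h4 : s.stk 4 = []) :
    Reaches testProg s ((18 * n + 87) * (R * (n + 1) + (l.flatMap App.encode).length) + 19)
      fun s' =>
        (∀ r, r = 8 ∨ 14 ≤ r → s'.reg r = s.reg r) ∧ s'.reg 4 = valueOf l c ∧
        s'.stk 0 = l.flatMap App.encode ∧ ∀ k, k ≠ 0 → s'.stk k = s.stk k := by
  obtain ⟨s₁, e1, a1, a2, a3, a4, a5⟩ := evalProg_reaches s h14 h15 h3
  obtain ⟨s₂, e2, b1, b2, b3, b4⟩ := restoreLoop_reaches s₁ (by rw [a1 14 (by simp), h14])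
  refine ⟨s₂, (e1.seq e2).mono ?_, ?_, ?_, ?_, ?_⟩
  · have hlen : (s.stk 0).length ≤ R * (n + 1) + (l.flatMap App.encode).length := by
      rw [h0, List.length_append]
      exact Nat.add_le_add_right (hashWord_length g) _
    have e : (s.stk 2).length = n := by simp [h2, bits]
    have e4 : (s₁.stk 4).length = (s.stk 0).length := by simp [a4, h4]
    rw [e, e4]
    nlinarith
  · intro r hr
    rw [b1 r (by lia), a1 r hr]
  · have : s₁.reg 4 = (EvalState.of s₁).value := rfl
    rw [b1 4 (by simp), this, a2, h0, h2, (evalWord_hash_apps (represents_ofFn c) g l).2]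
  · rw [b2, a3, a4, h4, h0, List.append_nil, List.append_nil, ← List.filter_reverse,
      List.reverse_reverse, filter_word]
  · intro k hk
    by_cases k4 : k = 4
    · subst k4
      rw [b3, h4]
    · rw [b4 k hk k4, a5 k hk k4]

/-- The memory between two rounds: `c` is the current assignment and `j` is the number of
rounds to come. -/
structure Ready {n : ℕ} (l : List (App n)) (c : Fin n → Bool) (j : ℝ) (s : Store) : Prop where
  word : s.stk 0 = l.flatMap App.encode
  current : s.stk 1 = bits (List.ofFn c)
  stk2 : s.stk 2 = []
  stk3 : s.stk 3 = []
  stk4 : s.stk 4 = []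
  value : s.reg 8 = valueOf l c
  zero : s.reg 14 = 0
  one : s.reg 15 = 1
  vars : s.reg 17 = n
  half : s.reg 21 = 1 / 2
  marker : s.reg 22 = -(1 / 2)
  rounds : s.reg 20 = j

/-- Replace the current assignment by the one on stack `2` if that has a larger value. -/
def replaceProg : Prog :=
  .seq (.ite (.le 4 8) (moveAll 2 5)
    (.seq (.instr (.copy 8 4)) (.seq (moveAll 1 5) (.seq (moveAll 2 3) (moveAll 3 1)))))
    (.instr (.sub 20 20 15))

-- Stack 5 only receives discarded words. The new assignment passes through stack 3 because each
-- move reverses it.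
open Classical in
theorem replaceProg_reaches {n : ℕ} {l : List (App n)} {c d : Fin n → Bool} {j : ℝ} {s : Store}
    (h : Ready l c (j + 1) { s with stk := Function.update s.stk 2 [] })
    (h2 : s.stk 2 = bits (List.ofFn d)) (h4 : s.reg 4 = valueOf l d) :
    Reaches replaceProg s (12 * n + 10)
      (Ready l (if valueOf l d ≤ valueOf l c then c else d) j) := by
  obtain ⟨k0, k1, -, k3, k4, r8, r14, r15, r17, r21, r22, r20⟩ := h
  simp only [ne_eq, not_false_eq_true, Nat.reduceEqDiff, Function.update_of_ne,
    OfNat.zero_ne_ofNat, OfNat.one_ne_ofNat] at k0 k1 k3 k4 r8 r14 r15 r17 r21 r22 r20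
  by_cases hv : valueOf l d ≤ valueOf l c
  · rw [if_pos hv]
    obtain ⟨s₁, e1, a1, a2, a3, a4⟩ := moveAll_reaches (a := 2) (b := 5) (by decide) s
    refine ⟨_, ((Ends.ite_true ?_ e1).seq (Ends.instr _ _)).mono ?_, ?_⟩
    · simpa only [Test.Holds, h4, r8] using hv
    · simp [h2, bits]
      lia
    · constructor <;> simp [Instr.exec, *]
  · rw [if_neg hv]
    obtain ⟨s₁, e1, a1, a2, a3, a4⟩ := moveAll_reaches (a := 1) (b := 5) (by decide)
      (Instr.exec (.copy 8 4) s)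
    obtain ⟨s₂, e2, b1, b2, b3, b4⟩ := moveAll_reaches (a := 2) (b := 3) (by decide) s₁
    obtain ⟨s₃, e3, c1, c2, c3, c4⟩ := moveAll_reaches (a := 3) (b := 1) (by decide) s₂
    have i1 : s₁.stk 2 = bits (List.ofFn d) := by
      rw [a4 2 (by simp) (by simp)]
      simpa [Instr.exec] using h2
    have i2 : s₂.stk 3 = (bits (List.ofFn d)).reverse := by
      rw [b3, i1, a4 3 (by simp) (by simp)]
      simpa [Instr.exec] using k3
    have i3 : s₃.stk 1 = bits (List.ofFn d) := by
      rw [c3, i2, b4 1 (by simp) (by simp), a2]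
      simp
    refine ⟨_, ((Ends.ite_false ?_ ((Ends.instr _ _).seq (e1.seq (e2.seq e3)))).seq
      (Ends.instr _ _)).mono ?_, ?_⟩
    · simpa only [Test.Holds, h4, r8] using hv
    · rw [i1, i2]
      simp [Instr.exec, k1, bits]
      lia
    · constructor <;> simp [Instr.exec, *]

/-- Round the answer on stack `6` to an assignment and compare it with the current one. -/
def answerProg : Prog :=
  .seq (.instr (.copy 18 17)) (.seq roundingLoop (.seq (moveAll 3 2)
    (.seq (.instr (.pop 8 0)) (.seq testProg replaceProg))))

open Classical in
/-- The assignment that is kept after the answer `z`. -/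
def advance {n : ℕ} (l : List (App n)) (c : Fin n → Bool) (z : List ℝ) : Fin n → Bool :=
  if valueOf l (toAssignment n z) ≤ valueOf l c then c else toAssignment n z

/-- The threshold popped from the query is the current value, so register 8 holds the right number
for the comparison. This holds for every answer `z`, correct or not. -/
theorem answerProg_reaches {R n : ℕ} {l : List (App n)} {c : Fin n → Bool} {j : ℝ} {s : Store}
    (g : Fin R → Fin n → Bool) (z : List ℝ)
    (h : Ready l c (j + 1) { s with stk := Function.update s.stk 0 (l.flatMap App.encode) })
    (h0 : s.stk 0 = query (valueOf l c) g l) (h6 : s.stk 6 = z) :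
    Reaches answerProg s
      ((18 * n + 87) * (R * (n + 1) + (l.flatMap App.encode).length) + 26 * n + 40)
      (Ready l (advance l c z) j) := by
  obtain ⟨-, k1, k2, k3, k4, r8, r14, r15, r17, r21, r22, r20⟩ := h
  simp only [ne_eq, OfNat.ofNat_ne_zero, one_ne_zero, not_false_eq_true,
    Function.update_of_ne] at k1 k2 k3 k4 r8 r14 r15 r17 r21 r22 r20
  obtain ⟨s₁, e1, a1, a2, a3⟩ := roundingLoop_reaches n (Instr.exec (.copy 18 17) s)
    (by simpa [Instr.exec] using r14) (by simpa [Instr.exec] using r15)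
    (by simpa [Instr.exec] using r17)
  have a1' : ∀ r, r ≠ 13 → r ≠ 18 → s₁.reg r = s.reg r := fun r p q => by
    rw [a1 r p q]
    simp [Instr.exec, q]
  have a2' : s₁.stk 3 = (bits (List.ofFn (toAssignment n z))).reverse := by
    rw [a2]
    simp [Instr.exec, h6, k3]
  have a3' : ∀ k, k ≠ 3 → k ≠ 6 → s₁.stk k = s.stk k := fun k p q => by
    rw [a3 k p q]
    simp [Instr.exec]
  obtain ⟨s₂, e2, b1, b2, b3, b4⟩ := moveAll_reaches (a := 3) (b := 2) (by decide) s₁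
  have b3' : s₂.stk 2 = bits (List.ofFn (toAssignment n z)) := by
    rw [b3, a2', a3' 2 (by simp) (by simp), k2]
    simp
  set s₃ := Instr.exec (.pop 8 0) s₂ with hs₃
  have q0 : s₂.stk 0 = query (valueOf l c) g l := by
    rw [b4 0 (by simp) (by simp), a3' 0 (by simp) (by simp), h0]
  have d1 : ∀ r, r = 8 ∨ 14 ≤ r → r ≠ 18 → s₃.reg r = s.reg r := fun r hr h18 => by
    by_cases h8 : r = 8
    · subst h8
      simp [hs₃, Instr.exec, q0, query, r8]
    · simp [hs₃, Instr.exec, h8]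
      rw [b1 r (by lia), a1' r (by lia) h18]
  have d2 : s₃.stk 0 = hashWord g ++ l.flatMap App.encode := by
    simp [hs₃, Instr.exec, q0, query]
  have d3 : ∀ k, k ≠ 0 → s₃.stk k = s₂.stk k := fun k hk => by
    simp [hs₃, Instr.exec, hk]
  obtain ⟨s₄, e4, f1, f2, f3, f4⟩ := testProg_reaches g l (toAssignment n z) s₃
    (by rw [d1 14 (by simp) (by simp), r14]) (by rw [d1 15 (by simp) (by simp), r15]) d2
    (by rw [d3 2 (by simp), b3']) (by rw [d3 3 (by simp), b2])
    (by rw [d3 4 (by simp), b4 4 (by simp) (by simp), a3' 4 (by simp) (by simp), k4])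
  have g1 : ∀ r, r = 8 ∨ 14 ≤ r → r ≠ 18 → s₄.reg r = s.reg r := fun r hr h18 => by
    rw [f1 r hr, d1 r hr h18]
  have g2 : ∀ k, k ≠ 0 → k ≠ 2 → k ≠ 3 → k ≠ 6 → s₄.stk k = s.stk k := fun k p q u v => by
    rw [f4 k p, d3 k p, b4 k u q, a3' k u v]
  have g3 : s₄.stk 3 = [] := by rw [f4 3 (by simp), d3 3 (by simp), b2]
  obtain ⟨s₅, e5, h5⟩ := replaceProg_reaches (s := s₄) (l := l) (c := c)
    (d := toAssignment n z) (j := j)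
    (by constructor <;> simp [f3, g1, g2, g3, k1, k4, r8, r14, r15, r17, r20, r21, r22])
    (by rw [f4 2 (by simp), d3 2 (by simp), b3']) f2
  refine ⟨s₅, ((Ends.instr _ _).seq (e1.seq (e2.seq ((Ends.instr _ _).seq (e4.seq e5))))).mono ?_,
    ?_⟩
  · rw [a2']
    simp [bits]
    lia
  · exact h5

/-! ### Rounds -/

/-- `n + 2` checks suffice: isolation uses a prefix of length `log₂ |S| + 2`, and `|S| ≤ 2 ^ n`. -/
def hashSetup : Prog :=
  block [.instr (.copy 19 17), .instr (.add 19 19 15), .instr (.add 19 19 15)]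

/-- Ask the oracle for an improvement that passes random parity checks. -/
def roundProg : Prog :=
  .seq hashSetup (.seq hashLoop (.seq (.instr (.push 0 8)) (.seq (.query 0 21 6) answerProg)))

/-- The expectation of `Φ` over the assignment kept after one round from `c`. -/
def round {n : ℕ} (O : Oracle) (l : List (App n)) (Φ : (Fin n → Bool) → ℝ≥0∞)
    (c : Fin n → Bool) : ℝ≥0∞ :=
  mean fun g : Fin (n + 2) → Fin n → Bool =>
    ∑' z, O (query (valueOf l c) g l) (1 / 2) z * Φ (advance l c z)

/-- A bound on the running time of a round with `n` variables and `w` further entries. -/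
def roundTime {A : Type*} [CommSemiring A] (n w : A) : A :=
  (18 * n + 87) * ((n + 2) * (n + 1) + w) + (12 * n + 8) * (n + 2) + 26 * n + 60

/-- The checks contribute the outer average and the query the inner sum of `round`; what follows the
query is deterministic. -/
theorem roundProg_expect {O : Oracle} {ψ : Store → ℝ≥0∞} {n : ℕ} {l : List (App n)}
    {c : Fin n → Bool} {j : ℝ} {s : Store} (h : Ready l c (j + 1) s)
    (Φ : (Fin n → Bool) → ℝ≥0∞) (K : List Prog) (m : ℕ)
    (hK : ∀ c' s', Ready l c' j s' → Φ c' ≤ expect O ψ m ⟨K, s'⟩) :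
    round O l Φ c ≤
      expect O ψ (m + roundTime n (l.flatMap App.encode).length) ⟨roundProg :: K, s⟩ := by
  set w := (l.flatMap App.encode).length with hw
  have ht : m + roundTime n w = m + ((18 * n + 87) * ((n + 2) * (n + 1) + w) + 26 * n + 40) + 1 + 1
      + 1 + 1 + ((12 * n + 8) * (n + 2) + 1) + 1 + 13 + 1 := by
    simp only [roundTime]
    ring
  obtain ⟨k0, k1, k2, k3, k4, r8, r14, r15, r17, r21, r22, r20⟩ := h
  have hS : hashSetup.Straight := by simp [hashSetup, block, Prog.Straight]
  have hr : ∀ r, r ≠ 19 → (hashSetup.effect s).reg r = s.reg r := fun r hr => by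
    simp [hashSetup, block, Prog.effect, Instr.exec, hr]
  have hk : (hashSetup.effect s).stk = s.stk := by
    simp [hashSetup, block, Prog.effect, Instr.exec]
  have h19 : (hashSetup.effect s).reg 19 = ((n + 2 : ℕ) : ℝ) := by
    simp [hashSetup, block, Prog.effect, Instr.exec, r15, r17]
    ring
  rw [ht, roundProg, expect_seq]
  refine le_trans ?_ ((hS.ends s).mono (show hashSetup.nodes ≤ 13 by
    simp [hashSetup, block, Prog.nodes]) O ψ _ _)
  rw [expect_seq]
  refine hashLoop_expect _ _ n (n + 2) _ (by rw [hr 14 (by simp), r14])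
    (by rw [hr 15 (by simp), r15]) (by rw [hr 17 (by simp), r17]) h19
    (by rw [hr 22 (by simp), r22]) _ ?_
  intro g s₁ a1 a2 a3
  have a1' : ∀ r, r ≠ 12 → r ≠ 13 → r ≠ 18 → r ≠ 19 → s₁.reg r = s.reg r := fun r p q u v => by
    rw [a1 r p q u v, hr r v]
  have a2' : ∀ k, k ≠ 0 → s₁.stk k = s.stk k := fun k hk0 => by rw [a2 k hk0, hk]
  have a3' : s₁.stk 0 = hashWord g ++ l.flatMap App.encode := by rw [a3, hk, k0]
  rw [expect_seq]
  refine le_trans ?_ (Ends.instr (.push 0 8) s₁ O ψ _ _)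
  have hq : (Instr.exec (.push 0 8) s₁).stk 0 = query (valueOf l c) g l := by
    simp [Instr.exec, query, a1', a3', r8]
  rw [expect_seq, expect_query (by simp [Instr.exec, a1', r21]), hq]
  refine ENNReal.tsum_le_tsum fun z => mul_le_mul_right ?_ _
  obtain ⟨s', e, hs'⟩ := answerProg_reaches (l := l) (c := c) (j := j)
    (s := ⟨(Instr.exec (.push 0 8) s₁).reg,
      Function.update (Instr.exec (.push 0 8) s₁).stk 6 z⟩) g z
    (by constructor <;> simp [Instr.exec, *]) (by simpa using hq) (by simp)
  exact (hK _ s' hs').trans (e O ψ K m)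

/-- Repeat the rounds. -/
def roundLoop : Prog := .loop (.le 15 20) roundProg

theorem roundLoop_expect {O : Oracle} {ψ : Store → ℝ≥0∞} {n : ℕ} {l : List (App n)}
    (Φ : (Fin n → Bool) → ℝ≥0∞) (K : List Prog) (m : ℕ)
    (hK : ∀ c' s', Ready l c' 0 s' → Φ c' ≤ expect O ψ m ⟨K, s'⟩)
    (j : ℕ) (c : Fin n → Bool) (s : Store) (h : Ready l c j s) :
    (round O l)^[j] Φ c ≤
      expect O ψ (m + (j * (roundTime n (l.flatMap App.encode).length + 1) + 1))
        ⟨roundLoop :: K, s⟩ := by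
  induction j generalizing c s with
  | zero =>
    rw [roundLoop, zero_mul, zero_add, expect_loop_false (by simp [Test.Holds, h.one, h.rounds])]
    exact hK c s (by simpa using h)
  | succ j ih =>
    have hb : (Test.le 15 20).Holds s := by
      simp only [Test.Holds, h.one, h.rounds]
      push_cast
      linarith [Nat.cast_nonneg (α := ℝ) j]
    set T := roundTime n (l.flatMap App.encode).length
    have ht : m + ((j + 1) * (T + 1) + 1) = m + (j * (T + 1) + 1) + T + 1 := by ring
    rw [Function.iterate_succ_apply', roundLoop, ht, expect_loop_true hb]
    exact roundProg_expect (j := j) (by simpa using h) _ _ _ fun c' s' h' => ih c' s' h'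

/-! ### The complete program -/

def startProg : Prog :=
  block [.instr (.const 14 0), .instr (.const 15 1), .instr (.const 21 (1 / 2)),
    .instr (.const 22 (-(1 / 2))), .instr (.pop 9 0)]

def stripBody : Prog :=
  block [.instr (.push 1 14), .instr (.push 2 14), .instr (.add 17 17 15), .instr (.pop 9 0)]

/-- Remove the number of variables from stack `0` and write the zero assignment. -/
def stripLoop : Prog := .loop (.le 15 9) stripBody

/-- This sets the number of rounds to `16 (n + 2)`; 16 rounds more than halve the expected number of
better assignments. -/
def countProg : Prog :=
  block [.instr (.copy 8 4), .instr (.add 20 17 15), .instr (.add 20 20 15),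
    .instr (.const 13 16), .instr (.mul 20 20 13)]

/-- Evaluate the zero assignment. -/
def prepareProg : Prog :=
  .seq startProg (.seq stripLoop (.seq testProg (.seq countProg (moveAll 2 5))))

/-- Search for an optimal assignment with the help of the oracle. -/
def searchProg : Prog := .seq prepareProg roundLoop

/-- Register 9 is a look-ahead holding the last symbol popped; the 0 that ends the unary prefix
stops the loop. -/
theorem stripLoop_reaches (n : ℕ) (w : List ℝ) (s : Store) (h14 : s.reg 14 = 0)
    (h15 : s.reg 15 = 1) (h : s.reg 9 :: s.stk 0 = List.replicate n 1 ++ 0 :: w) :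
    Reaches stripLoop s (10 * n + 1) fun s' =>
      (∀ r, r ≠ 9 → r ≠ 17 → s'.reg r = s.reg r) ∧ s'.reg 17 = s.reg 17 + n ∧
      s'.stk 0 = w ∧ s'.stk 1 = List.replicate n 0 ++ s.stk 1 ∧
      s'.stk 2 = List.replicate n 0 ++ s.stk 2 ∧
      ∀ k, k ≠ 0 → k ≠ 1 → k ≠ 2 → s'.stk k = s.stk k := by
  induction n generalizing s with
  | zero =>
    rw [List.replicate_zero, List.nil_append, List.cons.injEq] at h
    refine ⟨s, (Ends.loop_false ?_).mono (by simp), ?_⟩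
    · simp only [Test.Holds, h15, h.1]
      norm_num
    · simp [h.2]
  | succ n ih =>
    rw [List.replicate_succ, List.cons_append, List.cons.injEq] at h
    have hS : stripBody.Straight := by simp [stripBody, block, Prog.Straight]
    have hreg : ∀ r, r ≠ 9 → r ≠ 17 → (stripBody.effect s).reg r = s.reg r := fun r p q => by
      simp [stripBody, block, Prog.effect, Instr.exec, p, q]
    have h17 : (stripBody.effect s).reg 17 = s.reg 17 + 1 := by
      simp [stripBody, block, Prog.effect, Instr.exec, h15]
    have hstk : ∀ k, k ≠ 0 → k ≠ 1 → k ≠ 2 → (stripBody.effect s).stk k = s.stk k :=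
      fun k p q u => by simp [stripBody, block, Prog.effect, Instr.exec, p, q, u]
    have h1 : (stripBody.effect s).stk 1 = 0 :: s.stk 1 := by
      simp [stripBody, block, Prog.effect, Instr.exec, h14]
    have h2 : (stripBody.effect s).stk 2 = 0 :: s.stk 2 := by
      simp [stripBody, block, Prog.effect, Instr.exec, h14]
    have h0 : (stripBody.effect s).reg 9 :: (stripBody.effect s).stk 0 =
        List.replicate n 1 ++ 0 :: w := by
      rw [← h.2]
      have : s.stk 0 ≠ [] := by simp [h.2]
      cases hs : s.stk 0 with
      | nil => exact absurd hs this
      | cons x u => simp [stripBody, block, Prog.effect, Instr.exec, hs]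
    obtain ⟨s', e, g1, g2, g3, g4, g5, g6⟩ := ih (stripBody.effect s)
      (by rw [hreg 14 (by simp) (by simp), h14]) (by rw [hreg 15 (by simp) (by simp), h15]) h0
    refine ⟨s', ((hS.ends s).loop_true ?_ e).mono ?_, ?_, ?_, g3, ?_, ?_, ?_⟩
    · simp only [Test.Holds, h15, h.1, le_refl]
    · have : stripBody.nodes = 9 := rfl
      lia
    · intro r p q
      rw [g1 r p q, hreg r p q]
    · rw [g2, h17]
      push_cast
      ring
    · rw [g4, h1, List.replicate_succ']
      simp
    · rw [g5, h2, List.replicate_succ']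
      simp
    · intro k p q u
      rw [g6 k p q u, hstk k p q u]

/-- A bound on the running time of the search. -/
def searchTime {A : Type*} [CommSemiring A] (n w : A) : A :=
  16 * (n + 2) * (roundTime n w + 1) + (18 * n + 87) * w + 14 * n + 50

theorem prepareProg_reaches {n : ℕ} (l : List (App n)) {x : List ℝ}
    (hX : x = List.replicate n 1 ++ 0 :: l.flatMap App.encode) (ε : ℝ) :
    Reaches prepareProg (load x [] ε) ((18 * n + 87) * (l.flatMap App.encode).length + 14 * n + 47)
      (Ready l (fun _ => false) ((16 * (n + 2) : ℕ) : ℝ)) := by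
  have hz : bits (List.ofFn fun _ : Fin n => false) = List.replicate n 0 := by
    simp [bits, List.ofFn_const]
  have hS : startProg.Straight := by simp [startProg, block, Prog.Straight]
  have hC : countProg.Straight := by simp [countProg, block, Prog.Straight]
  have e0 := hS.ends (load x [] ε)
  set s₀ := startProg.effect (load x [] ε) with hs₀
  have a14 : s₀.reg 14 = 0 := by simp [hs₀, startProg, block, Prog.effect, Instr.exec]
  have a15 : s₀.reg 15 = 1 := by simp [hs₀, startProg, block, Prog.effect, Instr.exec]
  have a21 : s₀.reg 21 = 1 / 2 := by simp [hs₀, startProg, block, Prog.effect, Instr.exec]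
  have a22 : s₀.reg 22 = -(1 / 2) := by simp [hs₀, startProg, block, Prog.effect, Instr.exec]
  have a17 : s₀.reg 17 = 0 := by simp [hs₀, startProg, block, Prog.effect, Instr.exec, load]
  have aw : s₀.reg 9 :: s₀.stk 0 = List.replicate n 1 ++ 0 :: l.flatMap App.encode := by
    rw [← hX]
    cases hx : x with
    | nil => simp [hX] at hx
    | cons y u => simp [hs₀, startProg, block, Prog.effect, Instr.exec, load, hx]
  have ak : ∀ k, k ≠ 0 → s₀.stk k = [] := fun k hk => by
    simp [hs₀, startProg, block, Prog.effect, Instr.exec, load, hk]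
  obtain ⟨s₁, e1, b1, b2, b3, b4, b5, b6⟩ := stripLoop_reaches n _ s₀ a14 a15 aw
  -- The bare instance is a query word with no parity checks, up to the threshold.
  obtain ⟨s₂, e2, c1, c2, c3, c4⟩ := testProg_reaches (R := 0) Fin.elim0 l (fun _ => false) s₁
    (by rw [b1 14 (by simp) (by simp), a14]) (by rw [b1 15 (by simp) (by simp), a15])
    (by simp [b3, hashWord]) (by rw [b5, hz, ak 2 (by simp), List.append_nil])
    (by rw [b6 3 (by simp) (by simp) (by simp), ak 3 (by simp)])
    (by rw [b6 4 (by simp) (by simp) (by simp), ak 4 (by simp)])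
  have e3 := hC.ends s₂
  set s₃ := countProg.effect s₂ with hs₃
  obtain ⟨s₄, e4, f1, f2, f3, f4⟩ := moveAll_reaches (a := 2) (b := 5) (by decide) s₃
  have d1 : ∀ r, 14 ≤ r → r ≠ 20 → r ≠ 17 → s₄.reg r = s₀.reg r := fun r p q u => by
    have h8 : r ≠ 8 := by lia
    have h13 : r ≠ 13 := by lia
    have h9 : r ≠ 9 := by lia
    rw [f1 r h13, ← b1 r h9 u, ← c1 r (Or.inr p)]
    simp [hs₃, countProg, block, Prog.effect, Instr.exec, q, h8, h13]
  have d2 : s₃.stk = s₂.stk := by simp [hs₃, countProg, block, Prog.effect, Instr.exec]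
  have v17 : s₂.reg 17 = n := by rw [c1 17 (by simp), b2, a17, zero_add]
  have v15 : s₂.reg 15 = 1 := by rw [c1 15 (by simp), b1 15 (by simp) (by simp), a15]
  have v2 : s₃.stk 2 = List.replicate n 0 := by
    rw [d2, c4 2 (by simp), b5, ak 2 (by simp), List.append_nil]
  have hready : Ready l (fun _ => false) ((16 * (n + 2) : ℕ) : ℝ) s₄ := by
    constructor
    · rw [f4 0 (by simp) (by simp), d2, c3]
    · rw [f4 1 (by simp) (by simp), d2, c4 1 (by simp), b4, ak 1 (by simp), hz, List.append_nil]
    · exact f2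
    · rw [f4 3 (by simp) (by simp), d2, c4 3 (by simp), b6 3 (by simp) (by simp) (by simp),
        ak 3 (by simp)]
    · rw [f4 4 (by simp) (by simp), d2, c4 4 (by simp), b6 4 (by simp) (by simp) (by simp),
        ak 4 (by simp)]
    · rw [f1 8 (by simp), ← c2]
      simp [hs₃, countProg, block, Prog.effect, Instr.exec]
    · rw [d1 14 (by simp) (by simp) (by simp), a14]
    · rw [d1 15 (by simp) (by simp) (by simp), a15]
    · rw [f1 17 (by simp), ← v17]
      simp [hs₃, countProg, block, Prog.effect, Instr.exec]
    · rw [d1 21 (by simp) (by simp) (by simp), a21]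
    · rw [d1 22 (by simp) (by simp) (by simp), a22]
    · rw [f1 20 (by simp)]
      simp [hs₃, countProg, block, Prog.effect, Instr.exec, v15, v17]
      ring
  refine ⟨s₄, (e0.seq (e1.seq (e2.seq (e3.seq e4)))).mono ?_, hready⟩
  have h1 : startProg.nodes = 11 := rfl
  have h2 : countProg.nodes = 11 := rfl
  rw [h1, h2, v2, List.length_replicate, zero_mul, zero_add]
  lia

theorem searchProg_expect {O : Oracle} {ψ : Store → ℝ≥0∞} {n : ℕ} (l : List (App n))
    {x : List ℝ} (hX : x = List.replicate n 1 ++ 0 :: l.flatMap App.encode) (ε : ℝ)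
    (Φ : (Fin n → Bool) → ℝ≥0∞) (hΦ : ∀ c s, s.stk 1 = bits (List.ofFn c) → Φ c ≤ ψ s) :
    (round O l)^[16 * (n + 2)] Φ (fun _ => false) ≤
      expect O ψ (searchTime n (l.flatMap App.encode).length) ⟨[searchProg], load x [] ε⟩ := by
  obtain ⟨s, e, hs⟩ := prepareProg_reaches l hX ε
  have key := roundLoop_expect (O := O) (ψ := ψ) (l := l) Φ [] 0
    (fun c' s' h' => by rw [expect_halted]; exact hΦ c' s' h'.current) _ _ s hs
  refine (key.trans (e O ψ _ _)).trans ?_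
  rw [← expect_seq]
  refine expect_mono _ ?_
  simp only [searchTime]
  lia

/-! ## Isolation by random parity checks -/

section

variable {n : ℕ}

theorem parity_eq (f z : Fin n → Bool) : parity f z = 1 ∨ parity f z = -1 := by
  unfold parity
  refine Finset.prod_induction _ (fun x : ℝ => x = 1 ∨ x = -1) ?_ (Or.inl rfl) ?_
  · rintro a b (rfl | rfl) (rfl | rfl) <;> simp
  · intro i _
    split_ifs <;> simp

/-- For fixed `f`, parity is a character of the group of binary vectors. -/
theorem parity_mul (f y z : Fin n → Bool) :
    parity f y * parity f z = parity f fun i => xor (y i) (z i) := by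
  unfold parity
  rw [← Finset.prod_mul_distrib]
  refine Finset.prod_congr rfl fun i _ => ?_
  beta_reduce
  generalize y i = a, z i = b
  cases f i <;> cases a <;> cases b <;> simp

/-- The sum over all checks factors over the variables, and the factor at `i` is `1 - 1 = 0`. -/
theorem sum_parity {z : Fin n → Bool} {i : Fin n} (hi : z i = true) : ∑ f, parity f z = 0 := by
  have h := Finset.prod_univ_sum (fun _ : Fin n => (Finset.univ : Finset Bool))
    fun i b => if b && z i then (-1 : ℝ) else 1
  rw [Fintype.piFinset_univ] at h
  unfold parity
  rw [← h]
  exact Finset.prod_eq_zero (Finset.mem_univ i) (by simp [hi])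

/-- The indicator of passing a parity check. -/
def passInd (f z : Fin n → Bool) : ℝ := (1 + parity f z) / 2

open Classical in
theorem passInd_eq (f z : Fin n → Bool) : passInd f z = if 1 ≤ parity f z then 1 else 0 := by
  unfold passInd
  rcases parity_eq f z with h | h
  · simp [h]
  · have : ¬ (1 : ℝ) ≤ -1 := by norm_num
    simp [h, this]

theorem card_assignments : (Fintype.card (Fin n → Bool) : ℝ) = 2 ^ n := by simp

theorem average_passInd {z : Fin n → Bool} {i : Fin n} (hi : z i = true) :
    (∑ f, passInd f z) / 2 ^ n = 1 / 2 := by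
  have h : ∑ f, passInd f z = 2 ^ n / 2 := by
    simp only [passInd, ← Finset.sum_div, Finset.sum_add_distrib, sum_parity hi]
    simp
  rw [h]
  field_simp

/-- Expanding `(1 + χ(y)) (1 + χ(z)) / 4`, only the constant term survives averaging, because `y`,
`z` and their sum modulo 2 are all nonzero. -/
theorem average_passInd_mul {y z : Fin n → Bool} {i j : Fin n} (hi : y i = true)
    (hj : z j = true) (hyz : y ≠ z) :
    (∑ f, passInd f y * passInd f z) / 2 ^ n = 1 / 4 := by
  obtain ⟨k, hk⟩ := Function.ne_iff.1 hyz
  have hx : xor (y k) (z k) = true := by simpa using hk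
  have h : ∀ f, passInd f y * passInd f z =
      (1 + parity f y + parity f z + parity f fun i => xor (y i) (z i)) / 4 := by
    intro f
    rw [← parity_mul, passInd, passInd]
    ring
  simp only [h, ← Finset.sum_div, Finset.sum_add_distrib, sum_parity hi, sum_parity hj,
    sum_parity (z := fun i => xor (y i) (z i)) hx]
  simp
  field_simp

/-- This is the independence of the rows: a sum of products over a finite product space is a product
of sums. -/
theorem average_prod {β : Type*} [Fintype β] {R : ℕ} (h : Fin R → β → ℝ) :
    (∑ g : Fin R → β, ∏ r, h r (g r)) / (Fintype.card β : ℝ) ^ R =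
      ∏ r, (∑ b, h r b) / Fintype.card β := by
  classical
  have e := Finset.prod_univ_sum (fun _ : Fin R => (Finset.univ : Finset β)) h
  rw [Fintype.piFinset_univ] at e
  rw [← e, Finset.prod_div_distrib]
  simp

theorem prod_ite_lt {R j : ℕ} (hj : j ≤ R) (x : ℝ) :
    ∏ r : Fin R, (if (r : ℕ) < j then x else 1) = x ^ j := by
  rw [Fin.prod_univ_eq_prod_range (fun r => if r < j then x else 1) R, Finset.prod_ite,
    Finset.prod_const, Finset.prod_const_one, mul_one]
  congr 1
  have : (Finset.range R).filter (fun r => r < j) = Finset.range j := by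
    ext r
    simp
    lia
  rw [this, Finset.card_range]

/-- The indicator of passing the first `j` parity checks. -/
def prefixInd {R : ℕ} (j : ℕ) (g : Fin R → Fin n → Bool) (z : Fin n → Bool) : ℝ :=
  ∏ r : Fin R, if (r : ℕ) < j then passInd (g r) z else 1

open Classical in
theorem prefixInd_eq {R j : ℕ} (hj : j ≤ R) (g : Fin R → Fin n → Bool) (z : Fin n → Bool) :
    prefixInd j g z = if j ≤ passes g z then 1 else 0 := by
  unfold prefixInd
  split_ifs with h
  · rw [le_passes_iff g z hj] at h
    refine Finset.prod_eq_one fun r _ => ?_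
    split_ifs with hr
    · rw [passInd_eq, if_pos (h r hr)]
    · rfl
  · rw [le_passes_iff g z hj] at h
    push Not at h
    obtain ⟨r, hr, hp⟩ := h
    refine Finset.prod_eq_zero (Finset.mem_univ r) ?_
    rw [if_pos hr, passInd_eq, if_neg (not_le.2 hp)]

/-- Among the assignments in `S`, only `z` passes the first `j` parity checks. -/
def Isolates {R : ℕ} (j : ℕ) (S : Finset (Fin n → Bool)) (g : Fin R → Fin n → Bool)
    (z : Fin n → Bool) : Prop :=
  j ≤ passes g z ∧ ∀ y ∈ S, j ≤ passes g y → y = z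

-- A union bound in pointwise form: if `z` passes but is not isolated, some other `y` passes too and
-- its term cancels the indicator.
open Classical in
theorem le_indicator_isolates {R j : ℕ} (hj : j ≤ R) (S : Finset (Fin n → Bool))
    (g : Fin R → Fin n → Bool) (z : Fin n → Bool) :
    prefixInd j g z - ∑ y ∈ S.erase z, prefixInd j g z * prefixInd j g y ≤
      if Isolates j S g z then 1 else 0 := by
  have h01 : ∀ y, 0 ≤ prefixInd j g y ∧ prefixInd j g y ≤ 1 := fun y => by
    rw [prefixInd_eq hj]
    split_ifs <;> simp
  have hs : ∀ y ∈ S.erase z, 0 ≤ prefixInd j g z * prefixInd j g y := fun y _ =>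
    mul_nonneg (h01 z).1 (h01 y).1
  split_ifs with h
  · linarith [Finset.sum_nonneg hs, (h01 z).2]
  · by_cases hz : j ≤ passes g z
    · obtain ⟨y, hyS, hy, hyz⟩ : ∃ y ∈ S, j ≤ passes g y ∧ y ≠ z := by
        by_contra hc
        push Not at hc
        exact h ⟨hz, hc⟩
      have := Finset.single_le_sum hs (Finset.mem_erase.2 ⟨hyz, hyS⟩)
      rw [prefixInd_eq hj g z, prefixInd_eq hj g y, if_pos hz, if_pos hy] at this
      rw [prefixInd_eq hj g z, if_pos hz]
      linarith
    · simp [prefixInd_eq hj g z, hz]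

theorem average_prefixInd {R j : ℕ} (hj : j ≤ R) {z : Fin n → Bool} {i : Fin n}
    (hi : z i = true) :
    (∑ g : Fin R → Fin n → Bool, prefixInd j g z) / (2 ^ n) ^ R = (1 / 2) ^ j := by
  have h := average_prod fun (r : Fin R) (f : Fin n → Bool) =>
    if (r : ℕ) < j then passInd f z else 1
  rw [card_assignments] at h
  unfold prefixInd
  rw [h, ← prod_ite_lt hj]
  refine Finset.prod_congr rfl fun r _ => ?_
  split_ifs
  · exact average_passInd hi
  · simp

theorem average_prefixInd_mul {R j : ℕ} (hj : j ≤ R) {y z : Fin n → Bool} {i k : Fin n}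
    (hi : y i = true) (hk : z k = true) (hyz : y ≠ z) :
    (∑ g : Fin R → Fin n → Bool, prefixInd j g y * prefixInd j g z) / (2 ^ n) ^ R =
      (1 / 4) ^ j := by
  have h := average_prod fun (r : Fin R) (f : Fin n → Bool) =>
    (if (r : ℕ) < j then passInd f y else 1) * if (r : ℕ) < j then passInd f z else 1
  rw [card_assignments] at h
  simp only [prefixInd, ← Finset.prod_mul_distrib]
  rw [h, ← prod_ite_lt hj]
  refine Finset.prod_congr rfl fun r _ => ?_
  split_ifs
  · exact average_passInd_mul hi hk hyz
  · simp

-- Averaging the union bound gives the Valiant–Vazirani estimate: the first moment of `z` is `2 ^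
-- (-j)`, and each competing pair costs `4 ^ (-j)` by pairwise independence.
open Classical in
theorem le_average_isolates {R j : ℕ} (hj : j ≤ R) {S : Finset (Fin n → Bool)}
    (hS : ∀ y ∈ S, ∃ i, y i = true) {z : Fin n → Bool} (hz : z ∈ S) :
    (1 / 2) ^ j - S.card * (1 / 4) ^ j ≤
      (∑ g : Fin R → Fin n → Bool, if Isolates j S g z then (1 : ℝ) else 0) / (2 ^ n) ^ R := by
  obtain ⟨i, hi⟩ := hS z hz
  have h1 : ∑ y ∈ S.erase z, (∑ g : Fin R → Fin n → Bool, prefixInd j g z * prefixInd j g y) /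
      (2 ^ n) ^ R ≤ S.card * (1 / 4) ^ j := by
    calc _ = ∑ y ∈ S.erase z, (1 / 4 : ℝ) ^ j := by
          refine Finset.sum_congr rfl fun y hy => ?_
          obtain ⟨hyz, hyS⟩ := Finset.mem_erase.1 hy
          obtain ⟨k, hk⟩ := hS y hyS
          exact average_prefixInd_mul hj hi hk hyz.symm
      _ ≤ S.card * (1 / 4) ^ j := by
          rw [Finset.sum_const, nsmul_eq_mul]
          refine mul_le_mul_of_nonneg_right ?_ (by positivity)
          exact_mod_cast Finset.card_le_card (Finset.erase_subset _ _)
  calc (1 / 2 : ℝ) ^ j - S.card * (1 / 4) ^ j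
      ≤ (∑ g : Fin R → Fin n → Bool, prefixInd j g z) / (2 ^ n) ^ R -
        ∑ y ∈ S.erase z, (∑ g : Fin R → Fin n → Bool, prefixInd j g z * prefixInd j g y) /
          (2 ^ n) ^ R := by
        rw [average_prefixInd hj hi]
        linarith
    _ = (∑ g : Fin R → Fin n → Bool, (prefixInd j g z -
          ∑ y ∈ S.erase z, prefixInd j g z * prefixInd j g y)) / (2 ^ n) ^ R := by
        rw [Finset.sum_sub_distrib, Finset.sum_comm, sub_div, ← Finset.sum_div]
    _ ≤ _ := by
        refine div_le_div_of_nonneg_right ?_ (by positivity)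
        exact Finset.sum_le_sum fun g _ => le_indicator_isolates hj S g z

/-! ## Progress of a round -/

/-- The assignments that are better than `c`. -/
def better (l : List (App n)) (c : Fin n → Bool) : Finset (Fin n → Bool) := by
  classical exact Finset.univ.filter fun z => valueOf l c < valueOf l z

theorem mem_better {l : List (App n)} {c z : Fin n → Bool} :
    z ∈ better l c ↔ valueOf l c < valueOf l z := by simp [better]

theorem card_better_le {l : List (App n)} {c d : Fin n → Bool} (h : valueOf l c ≤ valueOf l d) :
    (better l d).card ≤ (better l c).card :=
  Finset.card_le_card fun _ hz => mem_better.2 (h.trans_lt (mem_better.1 hz))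

theorem card_better_le_pow (l : List (App n)) (c : Fin n → Bool) :
    (better l c).card ≤ 2 ^ n := by
  simpa using Finset.card_le_univ (better l c)

/-- On average, at least half of the better assignments are not better than a given one. -/
theorem sum_card_better (l : List (App n)) (c : Fin n → Bool) :
    ((better l c).card : ℝ) ^ 2 / 2 ≤
      ∑ z ∈ better l c, (((better l c).card : ℝ) - (better l z).card) := by
  classical
  set S := better l c with hS
  have h1 : ∀ z ∈ S, ((better l z).card : ℝ) =
      ∑ y ∈ S, if valueOf l z < valueOf l y then (1 : ℝ) else 0 := by
    intro z hz
    rw [Finset.sum_boole]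
    congr 2
    ext y
    rw [Finset.mem_filter, mem_better]
    exact ⟨fun h => ⟨mem_better.2 ((mem_better.1 hz).trans h), h⟩, fun h => h.2⟩
  have h2 : 2 * ∑ z ∈ S, ((better l z).card : ℝ) ≤ (S.card : ℝ) ^ 2 := by
    rw [Finset.sum_congr rfl h1]
    -- For a pair `(z, y)` at most one of the two strict inequalities holds, so the sum added to its
    -- transpose is at most `|S| ^ 2`.
    have h3 : ∑ z ∈ S, ∑ y ∈ S, (if valueOf l z < valueOf l y then (1 : ℝ) else 0) =
        ∑ z ∈ S, ∑ y ∈ S, if valueOf l y < valueOf l z then (1 : ℝ) else 0 := Finset.sum_comm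
    rw [two_mul]
    nth_rewrite 2 [h3]
    rw [← Finset.sum_add_distrib]
    calc _ ≤ ∑ z ∈ S, ∑ y ∈ S, (1 : ℝ) := by
          refine Finset.sum_le_sum fun _ _ => ?_
          rw [← Finset.sum_add_distrib]
          refine Finset.sum_le_sum fun y _ => ?_
          split_ifs with p q
          · exact absurd p q.not_gt
          all_goals norm_num
      _ = (S.card : ℝ) ^ 2 := by
          simp
          ring
  rw [Finset.sum_sub_distrib, Finset.sum_const, nsmul_eq_mul]
  nlinarith

theorem le_valueOf_advance (l : List (App n)) (c : Fin n → Bool) (z : List ℝ) :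
    valueOf l c ≤ valueOf l (advance l c z) := by
  unfold advance
  split_ifs with h
  · exact le_rfl
  · exact (not_le.1 h).le

theorem le_hashWord_length {R : ℕ} (g : Fin R → Fin n → Bool) : R ≤ (hashWord g).length := by
  induction R with
  | zero => simp
  | succ R ih =>
    rw [← Fin.snoc_init_self g, hashWord_snoc, List.length_append, List.length_append]
    have := ih (Fin.init g)
    simp
    lia

theorem toAssignment_bits (y : List Bool) :
    toAssignment n (bits y) = fun i : Fin n => y.getD i false := by
  funext i
  have h : ¬ (1 : ℝ) ≤ 0 := by norm_num
  have := represents_bits (n := n) y i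
  rw [pick_natCast] at this
  rw [toAssignment, this]
  change decide (1 ≤ bit (y.getD i false)) = y.getD i false
  generalize y.getD i false = b
  cases b <;> simp [bit, h]

/-- A good answer of the oracle is the isolated assignment. -/
theorem advance_eq_of_isolates {l : List (App n)} {c d : Fin n → Bool} {j : ℕ}
    {g : Fin (n + 2) → Fin n → Bool} (hg : Isolates j (better l c) g d) (hd : d ∈ better l c)
    {y : List Bool}
    (hy : improvement.IsApprox ((2 : ℝ) ^ (1 / 2 : ℝ)) (query (valueOf l c) g l) y) :
    advance l c (bits y) = d := by
  -- `d` is short enough to be a solution: the `n + 2` end markers of the checks make the query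
  -- longer than `n`.
  have h1 := score_le_of_isApprox hy (z := List.ofFn d) (by
    have := le_hashWord_length g
    simp [query]
    lia)
  have hypos := (score_bounds (query (valueOf l c) g l) (bits y)).1
  have hr : (2 : ℝ) ^ (1 / 2 : ℝ) < 2 := by
    calc (2 : ℝ) ^ (1 / 2 : ℝ) < 2 ^ (1 : ℝ) :=
          Real.rpow_lt_rpow_of_exponent_lt (by norm_num) (by norm_num)
      _ = 2 := by simp
  have h3 : score (query (valueOf l c) g l) (bits (List.ofFn d)) <
      score (query (valueOf l c) g l) (bits y) * 2 := by
    refine h1.trans_lt ?_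
    exact mul_lt_mul_of_pos_left hr (by linarith)
  rw [score_query (represents_ofFn d), score_query (represents_bits (n := n) y),
    if_neg (not_le.2 (mem_better.1 hd)), pow_succ] at h3
  have h4 : (2 : ℝ) ^ j ≤ 2 ^ passes g d := pow_le_pow_right₀ (by norm_num) hg.1
  rw [advance, toAssignment_bits]
  -- An answer that is no improvement has score 1, too small by more than the factor allowed;
  -- otherwise the score forces at least `j` passed checks, and isolation applies.
  split_ifs at h3 with hv
  · have : (1 : ℝ) ≤ 2 ^ passes g d := one_le_pow₀ (by norm_num)
    linarith
  · rw [if_neg hv]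
    refine hg.2 _ (mem_better.2 (not_le.1 hv)) ?_
    have h5 : (2 : ℝ) ^ j < 2 ^ (passes g (fun i : Fin n => y.getD i false) + 1) := by linarith
    have := (pow_lt_pow_iff_right₀ (by norm_num : (1 : ℝ) < 2)).1 h5
    lia

end

/-! ### Expected decrease of the number of better assignments, and the success probability -/

section

variable {n : ℕ} {l : List (App n)} {O : Oracle}

/-- Truncation at 0 is subadditive, so averages computed with signed reals remain lower bounds for
averages of nonnegative quantities. -/
theorem ofReal_average_le_mean {α : Type*} [Fintype α] [Nonempty α] (h : α → ℝ) :
    ENNReal.ofReal ((∑ a, h a) / Fintype.card α) ≤ mean fun a => ENNReal.ofReal (h a) := by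
  have hs : ∀ S : Finset α, ENNReal.ofReal (∑ a ∈ S, h a) ≤ ∑ a ∈ S, ENNReal.ofReal (h a) := by
    classical
    intro S
    induction S using Finset.induction_on with
    | empty => simp
    | insert a S ha ih =>
      rw [Finset.sum_insert ha, Finset.sum_insert ha]
      exact ENNReal.ofReal_add_le.trans (add_le_add_right ih _)
  have hc : (0 : ℝ) < Fintype.card α := by exact_mod_cast Fintype.card_pos
  rw [mean, ENNReal.ofReal_div_of_pos hc, ENNReal.ofReal_natCast, div_eq_mul_inv, mul_comm]
  exact mul_le_mul_right (hs _) _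

/-- An average that is at least `x` everywhere, and at least `y` with probability `3 / 4`. -/
theorem le_tsum_of_prob {α : Type*} (p : PMF α) (f : α → ℝ≥0∞) {A : Set α}
    (hA : 3 / 4 ≤ p.toOuterMeasure A) {x y : ℝ≥0∞} (hxy : x ≤ y) (hx : ∀ a, x ≤ f a)
    (hy : ∀ a ∈ A, y ≤ f a) : x + 3 / 4 * (y - x) ≤ ∑' a, p a * f a := by
  classical
  calc x + 3 / 4 * (y - x) ≤ x + p.toOuterMeasure A * (y - x) := by gcongr
    _ = ∑' a, p a * (x + if a ∈ A then y - x else 0) := by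
        simp only [mul_add]
        rw [ENNReal.tsum_add, ENNReal.tsum_mul_right, PMF.tsum_coe, one_mul,
          PMF.toOuterMeasure_apply, ← ENNReal.tsum_mul_right]
        congr 1
        refine tsum_congr fun a => ?_
        by_cases h : a ∈ A <;> simp [h]
    _ ≤ ∑' a, p a * f a := by
        refine ENNReal.tsum_le_tsum fun a => mul_le_mul_right ?_ _
        split_ifs with h
        · rw [add_tsub_cancel_of_le hxy]
          exact hy a h
        · simpa using hx a

open Classical in
/-- The expected progress of a round, given the parity checks. -/
theorem le_answer (hO : improvement.IsRandomizedScheme fun Y δ => O (improvement.encode Y) δ)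
    {c : Fin n → Bool} {a : ℝ} (ha : 0 ≤ a) {Ψ : (Fin n → Bool) → ℝ≥0∞}
    (hΨ : ∀ d, valueOf l c ≤ valueOf l d → ENNReal.ofReal (1 - (better l d).card * a) ≤ Ψ d)
    (j : ℕ) (g : Fin (n + 2) → Fin n → Bool) :
    ENNReal.ofReal (1 - (better l c).card * a + 3 / 4 * a * ∑ d ∈ better l c,
        (if Isolates j (better l c) g d then (1 : ℝ) else 0) *
          (((better l c).card : ℝ) - (better l d).card)) ≤
      ∑' z, O (query (valueOf l c) g l) (1 / 2) z * Ψ (advance l c z) := by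
  set S := better l c with hS
  set φ : (Fin n → Bool) → ℝ≥0∞ := fun d => ENNReal.ofReal (1 - (better l d).card * a) with hφ
  have hmono : ∀ d, valueOf l c ≤ valueOf l d → φ c ≤ φ d := fun d hd => by
    refine ENNReal.ofReal_le_ofReal ?_
    have : ((better l d).card : ℝ) ≤ (better l c).card := by exact_mod_cast card_better_le hd
    nlinarith
  have hlow : ∀ z, φ c ≤ Ψ (advance l c z) := fun z =>
    (hmono _ (le_valueOf_advance l c z)).trans (hΨ _ (le_valueOf_advance l c z))
  by_cases hex : ∃ d ∈ S, Isolates j S g d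
  · obtain ⟨d, hd, hiso⟩ := hex
    -- At most one element of `S` can be isolated, so the sum has a single term.
    have hsum : ∑ e ∈ S, (if Isolates j S g e then (1 : ℝ) else 0) *
        ((S.card : ℝ) - (better l e).card) = S.card - (better l d).card := by
      rw [Finset.sum_eq_single_of_mem d hd, if_pos hiso, one_mul]
      intro e he hed
      rw [if_neg, zero_mul]
      exact fun h => hed (hiso.2 e he h.1)
    have hvd : valueOf l c ≤ valueOf l d := (mem_better.1 hd).le
    have hA := hO (query (valueOf l c) g l) (1 / 2) (by norm_num) (by norm_num)
    refine le_trans ?_ (le_tsum_of_prob _ (fun z => Ψ (advance l c z)) hA (hmono d hvd) hlow ?_)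
    · rw [hsum]
      have h1 : ENNReal.ofReal (3 / 4) = 3 / 4 := by
        rw [ENNReal.ofReal_div_of_pos (by norm_num)]
        norm_num
      have h2 : φ d - φ c + φ c = φ d := tsub_add_cancel_of_le (hmono d hvd)
      have h3 : φ c = 1 / 4 * φ c + 3 / 4 * φ c := by
        rw [← add_mul, ENNReal.div_add_div_same]
        norm_num
        rw [ENNReal.div_self (by norm_num) (by norm_num), one_mul]
      have h4 : φ c + 3 / 4 * (φ d - φ c) = 1 / 4 * φ c + 3 / 4 * φ d := by
        nth_rewrite 1 [h3]
        rw [add_assoc, ← mul_add, add_comm (φ c), h2]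
      have h5 : (1 / 4 : ℝ≥0∞) = ENNReal.ofReal (1 / 4) := by
        rw [ENNReal.ofReal_div_of_pos (by norm_num)]
        norm_num
      rw [h4, ← h1, h5, hφ]
      simp only
      rw [← ENNReal.ofReal_mul (by norm_num), ← ENNReal.ofReal_mul (by norm_num)]
      -- The bound is `φ c / 4 + 3 φ d / 4`; truncation only increases the right side of the
      -- identity between the untruncated values.
      refine le_trans (ENNReal.ofReal_le_ofReal (le_of_eq ?_)) ENNReal.ofReal_add_le
      ring
    · rintro z ⟨y, rfl, hy⟩
      rw [advance_eq_of_isolates hiso hd hy]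
      exact hΨ d hvd
  · have hsum : ∑ e ∈ S, (if Isolates j S g e then (1 : ℝ) else 0) *
        ((S.card : ℝ) - (better l e).card) = 0 := by
      refine Finset.sum_eq_zero fun e he => ?_
      rw [if_neg fun h => hex ⟨e, he, h⟩, zero_mul]
    rw [hsum, mul_zero, add_zero]
    calc φ c = ∑' z, O (query (valueOf l c) g l) (1 / 2) z * φ c := by
          rw [ENNReal.tsum_mul_right, PMF.tsum_coe, one_mul]
      _ ≤ _ := ENNReal.tsum_le_tsum fun z => mul_le_mul_right (hlow z) _

/-- The number of better assignments decreases by a constant factor in every round. -/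
theorem le_round (hO : improvement.IsRandomizedScheme fun Y δ => O (improvement.encode Y) δ)
    {c : Fin n → Bool} (hc : valueOf l (fun _ => false) ≤ valueOf l c) {a : ℝ} (ha : 0 ≤ a)
    {Ψ : (Fin n → Bool) → ℝ≥0∞}
    (hΨ : ∀ d, valueOf l c ≤ valueOf l d → ENNReal.ofReal (1 - (better l d).card * a) ≤ Ψ d) :
    ENNReal.ofReal (1 - (better l c).card * (61 / 64 * a)) ≤ round O l Ψ c := by
  classical
  set S := better l c with hS
  -- With this `j` one has `2 |S| ≤ 2 ^ j ≤ 4 |S|` when `S` is nonempty. The program never computes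
  -- it.
  set j := Nat.log 2 S.card + 2 with hj
  have hjn : j ≤ n + 2 := by
    have h1 : Nat.log 2 S.card ≤ Nat.log 2 (2 ^ n) := Nat.log_mono_right (card_better_le_pow l c)
    rw [Nat.log_pow (by norm_num)] at h1
    lia
  refine le_trans ?_ ((ofReal_average_le_mean _).trans
    (mean_mono fun g => le_answer (l := l) hO (c := c) ha hΨ j g))
  refine ENNReal.ofReal_le_ofReal ?_
  have hcard : (Fintype.card (Fin (n + 2) → Fin n → Bool) : ℝ) = (2 ^ n) ^ (n + 2) := by simp
  have hpos : (0 : ℝ) < (2 ^ n) ^ (n + 2) := by positivity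
  -- The zero vector passes every homogeneous check and could not be isolated. It is not in `S`,
  -- because `c` is at least as good as the zero assignment.
  have hnz : ∀ y ∈ S, ∃ i, y i = true := by
    intro y hy
    by_contra hcon
    push Not at hcon
    have : y = fun _ => false := funext fun i => by simpa using hcon i
    have hlt := mem_better.1 hy
    rw [this] at hlt
    linarith
  have hsplit : (∑ g : Fin (n + 2) → Fin n → Bool, (1 - (S.card : ℝ) * a + 3 / 4 * a *
      ∑ d ∈ S, (if Isolates j S g d then (1 : ℝ) else 0) * (S.card - (better l d).card))) /
        (2 ^ n) ^ (n + 2) =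
      1 - S.card * a + 3 / 4 * a * ∑ d ∈ S, ((∑ g : Fin (n + 2) → Fin n → Bool,
        if Isolates j S g d then (1 : ℝ) else 0) / (2 ^ n) ^ (n + 2)) *
          (S.card - (better l d).card) := by
    rw [Finset.sum_add_distrib, add_div, Finset.sum_const, nsmul_eq_mul, Finset.card_univ, hcard,
      mul_div_cancel_left₀ _ hpos.ne', ← Finset.mul_sum, Finset.sum_comm, mul_div_assoc,
      Finset.sum_div]
    congr 2
    refine Finset.sum_congr rfl fun d _ => ?_
    rw [← Finset.sum_mul]
    ring
  rw [hcard, ← hS, hsplit]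
  rcases Nat.eq_zero_or_pos S.card with h0 | h0
  · have : S = ∅ := Finset.card_eq_zero.1 h0
    simp [this]
  have hN : (0 : ℝ) < S.card := by exact_mod_cast h0
  have hlo : (2 : ℝ) ^ j ≤ 4 * S.card := by
    have := Nat.pow_log_le_self 2 h0.ne'
    have h2 : (2 : ℝ) ^ Nat.log 2 S.card ≤ S.card := by exact_mod_cast this
    rw [hj, pow_add]
    linarith
  have hhi : 2 * (S.card : ℝ) ≤ 2 ^ j := by
    have := Nat.lt_pow_succ_log_self (b := 2) (by norm_num) S.card
    have h2 : (S.card : ℝ) ≤ 2 ^ (Nat.log 2 S.card + 1) := by exact_mod_cast this.le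
    rw [hj, pow_succ]
    linarith
  -- The difference is `2 ^ (-j) (1 - |S| 2 ^ (-j))`, with first factor at least `1 / (4 |S|)` and
  -- second at least 1/2.
  have hq : 1 / (8 * (S.card : ℝ)) ≤ (1 / 2) ^ j - S.card * (1 / 4) ^ j := by
    have e4 : (1 / 4 : ℝ) ^ j = (1 / 2) ^ j * (1 / 2) ^ j := by
      rw [← mul_pow]
      norm_num
    have hjpos : (0 : ℝ) < 2 ^ j := by positivity
    have h1 : 1 / (4 * (S.card : ℝ)) ≤ (1 / 2) ^ j := by
      rw [one_div_pow]
      exact one_div_le_one_div_of_le hjpos hlo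
    have h2 : (S.card : ℝ) * (1 / 2) ^ j ≤ 1 / 2 := by
      rw [one_div_pow, mul_one_div, div_le_div_iff₀ hjpos (by norm_num)]
      linarith
    have h3 : 1 / (8 * (S.card : ℝ)) = 1 / (4 * (S.card : ℝ)) * (1 / 2) := by
      field_simp
      norm_num
    have h4 : (0 : ℝ) < (1 / 2) ^ j := by positivity
    rw [h3, e4]
    nlinarith
  have hsum : (S.card : ℝ) / 16 ≤ ∑ d ∈ S, ((∑ g : Fin (n + 2) → Fin n → Bool,
        if Isolates j S g d then (1 : ℝ) else 0) / (2 ^ n) ^ (n + 2)) *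
          (S.card - (better l d).card) := by
    calc (S.card : ℝ) / 16 = 1 / (8 * (S.card : ℝ)) * ((S.card : ℝ) ^ 2 / 2) := by
          field_simp
          norm_num
      _ ≤ 1 / (8 * (S.card : ℝ)) * ∑ d ∈ S, ((S.card : ℝ) - (better l d).card) :=
          mul_le_mul_of_nonneg_left (sum_card_better l c) (by positivity)
      _ ≤ _ := by
          rw [Finset.mul_sum]
          refine Finset.sum_le_sum fun d hd => mul_le_mul_of_nonneg_right ?_ ?_
          · exact hq.trans (le_average_isolates hjn hnz hd)
          · have : ((better l d).card : ℝ) ≤ S.card := by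
              exact_mod_cast card_better_le (mem_better.1 hd).le
            linarith
  -- The gain is `3/4 * a * |S| / 16 = 3/64 * a * |S|`, leaving the factor 61/64.
  nlinarith

/-- Markov's inequality is built into the potential: `1 - |better|` is at most the indicator of
optimality, and each round multiplies the coefficient of `|better|` by 61/64. The potential is
affine in `|better|` up to truncation, so expectations pass through the induction. -/
theorem le_iterate_round
    (hO : improvement.IsRandomizedScheme fun Y δ => O (improvement.encode Y) δ)
    {Φ : (Fin n → Bool) → ℝ≥0∞} (hΦ : ∀ c, (∀ d, valueOf l d ≤ valueOf l c) → 1 ≤ Φ c) (k : ℕ)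
    {c : Fin n → Bool} (hc : valueOf l (fun _ => false) ≤ valueOf l c) :
    ENNReal.ofReal (1 - (better l c).card * (61 / 64) ^ k) ≤ (round O l)^[k] Φ c := by
  induction k generalizing c with
  | zero =>
    rw [pow_zero, mul_one, Function.iterate_zero, id]
    rcases Nat.eq_zero_or_pos (better l c).card with h0 | h0
    · rw [h0]
      simp only [Nat.cast_zero, sub_zero, ENNReal.ofReal_one]
      refine hΦ c fun d => ?_
      by_contra hd
      have : d ∈ better l c := mem_better.2 (not_le.1 hd)
      rw [Finset.card_eq_zero.1 h0] at this
      simp at this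
    · have : (1 : ℝ) ≤ (better l c).card := by exact_mod_cast h0
      rw [ENNReal.ofReal_of_nonpos (by linarith)]
      exact zero_le
  | succ k ih =>
    rw [Function.iterate_succ_apply', pow_succ']
    exact le_round hO hc (by positivity) fun d hd => ih (hc.trans hd)

theorem three_quarters_le_iterate_round
    (hO : improvement.IsRandomizedScheme fun Y δ => O (improvement.encode Y) δ)
    {Φ : (Fin n → Bool) → ℝ≥0∞} (hΦ : ∀ c, (∀ d, valueOf l d ≤ valueOf l c) → 1 ≤ Φ c) :
    3 / 4 ≤ (round O l)^[16 * (n + 2)] Φ fun _ => false := by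
  refine le_trans ?_ (le_iterate_round hO hΦ _ le_rfl)
  have h1 : (3 / 4 : ℝ≥0∞) = ENNReal.ofReal (3 / 4) := by
    rw [ENNReal.ofReal_div_of_pos (by norm_num)]
    norm_num
  rw [h1]
  refine ENNReal.ofReal_le_ofReal ?_
  have h2 : ((better l fun _ => false).card : ℝ) ≤ 2 ^ n := by
    exact_mod_cast card_better_le_pow l _
  -- The constant 16 is chosen so that `(61 / 64) ^ 16 ≤ 1 / 2`.
  have h3 : ((61 : ℝ) / 64) ^ (16 * (n + 2)) ≤ (1 / 2) ^ (n + 2) := by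
    rw [pow_mul]
    exact pow_le_pow_left₀ (by positivity) (by norm_num) _
  have h4 : ((better l fun _ => false).card : ℝ) * (61 / 64) ^ (16 * (n + 2)) ≤
      2 ^ n * (1 / 2) ^ (n + 2) := mul_le_mul h2 h3 (by positivity) (by positivity)
  have h5 : (2 : ℝ) ^ n * (1 / 2) ^ (n + 2) = 1 / 4 := by
    rw [pow_add, ← mul_assoc, ← mul_pow]
    norm_num
  linarith

/-- No mass is lost in a round, for any oracle. This yields halting and the tolerance bound without
assuming that the answers are good. -/
theorem iterate_round_one (k : ℕ) (c : Fin n → Bool) :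
    (round O l)^[k] (fun _ => 1) c = 1 := by
  induction k generalizing c with
  | zero => rfl
  | succ k ih =>
    rw [Function.iterate_succ_apply', round]
    simp only [ih, mul_one, PMF.tsum_coe]
    exact mean_const 1

end

/-! ## The reduction is correct -/

theorem CSPInst.coe_value {F : Set Constraint} (X : CSPInst F) (y : List Bool) :
    (X.value y : ℝ) = valueOf X.apps fun i => y.getD i false := by
  rw [CSPInst.value, valueOf, NNReal.coe_list_prod, List.map_map]
  rfl

/-- An optimal assignment is its own witness: the ratio is 1, and a zero optimum is matched exactly.
-/
theorem isApprox_of_best {F : Set Constraint} (X : CSPInst F) {c : Fin X.numVars → Bool}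
    (hc : ∀ d, valueOf X.apps d ≤ valueOf X.apps c) {ε : ℝ} (hε : 0 < ε) :
    (maxProdCSP F).IsApprox ((2 : ℝ) ^ ε) X (List.ofFn c) := by
  have hsol : List.ofFn c ∈ (maxProdCSP F).sol X := by
    change (List.ofFn c).length = X.numVars
    simp
  have hcv : (X.value (List.ofFn c) : ℝ) = valueOf X.apps c := by
    rw [CSPInst.coe_value]
    simp
  have h2 : (1 : ℝ) ≤ 2 ^ ε := Real.one_le_rpow (by norm_num) hε.le
  refine ⟨hsol, List.ofFn c, ⟨hsol, fun z _ => ?_⟩, id, fun h => ?_⟩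
  · change X.value z ≤ X.value (List.ofFn c)
    rw [← NNReal.coe_le_coe, hcv, CSPInst.coe_value]
    exact hc _
  · rw [div_self (NNReal.coe_ne_zero.2 h), abs_one]
    exact ⟨(div_le_one (by linarith)).2 h2, h2⟩

theorem searchTime_mono {n n' w w' : ℕ} (hn : n ≤ n') (hw : w ≤ w') :
    searchTime n w ≤ searchTime n' w' := by
  unfold searchTime roundTime
  gcongr

theorem maxProdCSP_reduces (F : Set Constraint) : (maxProdCSP F).APTReduces improvement := by
  classical
  -- Every tolerance is 1/2, whence the constant 2. The time bound is one expression, evaluated both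
  -- in `ℕ` and in polynomials, with the instance size in place of both arguments.
  refine ⟨searchProg, 2, searchTime (MvPolynomial.X 0) (MvPolynomial.X 0), fun O hO => ?_⟩
  have htime : ∀ (X : CSPInst F) (ε : ℝ), searchTime X.numVars (X.apps.flatMap App.encode).length ≤
      ⌊(maxProdCSP F).polyVal (searchTime (MvPolynomial.X 0) (MvPolynomial.X 0)) X ε⌋₊ := by
    intro X ε
    have hlen : X.encode.length = X.numVars + ((X.apps.flatMap App.encode).length + 1) := by
      rw [CSPInst.encode, List.length_append, List.length_replicate, List.length_cons]
    have hval : (maxProdCSP F).polyVal (searchTime (MvPolynomial.X 0) (MvPolynomial.X 0)) X ε =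
        ((searchTime X.encode.length X.encode.length : ℕ) : ℝ) := by
      have : (maxProdCSP F).size X = X.encode.length := rfl
      simp [OptProblem.polyVal, searchTime, roundTime, this]
    rw [hval, Nat.floor_natCast]
    exact searchTime_mono (by lia) (by lia)
  -- Full mass for the constant 1 yields both the tolerance condition and halting below.
  have hone : ∀ (X : CSPInst F) (ε : ℝ), 1 ≤ expect O (fun _ => 1)
      ⌊(maxProdCSP F).polyVal (searchTime (MvPolynomial.X 0) (MvPolynomial.X 0)) X ε⌋₊
      ⟨[searchProg], load X.encode [] ε⟩ := fun X ε => by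
    have h := searchProg_expect (O := O) (ψ := fun _ => 1) X.apps (x := X.encode) rfl ε
      (fun _ => 1) (fun _ _ _ => le_rfl)
    rw [iterate_round_one] at h
    exact h.trans (expect_mono _ (htime X ε))
  refine ⟨fun X ε h0 _ => ?_, fun X ε _ _ => ⟨fun t c hc k d a K hK => ?_, fun c hc => ?_⟩⟩
  · have h := searchProg_expect (O := O)
      (ψ := fun s => if ∃ y, s.stk 1 = bits y ∧ (maxProdCSP F).IsApprox ((2 : ℝ) ^ ε) X y
        then 1 else 0) X.apps (x := X.encode) rfl ε
      (fun c => if ∀ d, valueOf X.apps d ≤ valueOf X.apps c then 1 else 0) (fun c s hs => by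
        split_ifs with h1 h2
        · exact le_rfl
        · exact absurd ⟨_, hs, isApprox_of_best X h1 h0⟩ h2
        · exact zero_le
        · exact le_rfl)
    have h34 := three_quarters_le_iterate_round (l := X.apps) hO
      (Φ := fun c => if ∀ d, valueOf X.apps d ≤ valueOf X.apps c then 1 else 0)
      (fun c hc => by rw [if_pos hc])
    rw [PMF.toOuterMeasure_map_apply]
    exact (h34.trans h).trans ((expect_mono _ (htime X ε)).trans (expect_indicator_le _ _ _))
  · have hb := not_badQuery_of_one_le_expect (fun _ => le_rfl) (hone X ε) t c hc
    have hd : c.store.reg d = 1 / 2 := by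
      by_contra hne
      exact hb ⟨k, d, a, K, hK, hne⟩
    refine ⟨⟨c.store.stk k, rfl⟩, ?_⟩
    rw [hd]
    refine ⟨by norm_num, by norm_num, ?_⟩
    simp [OptProblem.polyVal]
  · exact ⟨(halted_of_one_le_expect (fun _ => le_rfl) (hone X ε) c hc).1, trivial⟩

end MaxProd

end

theorem mainTheorem10 (F : Set MaxProd.Constraint) :
    (MaxProd.maxProdCSP F).APTReducesToClass MaxProd.OptProblem.EXPAPX :=
  ⟨MaxProd.improvement, MaxProd.improvement_mem_EXPAPX, MaxProd.maxProdCSP_reduces F⟩
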